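/- Let $I=[0,1]$ and let $f,g\colon I\to I$ be continuous and piecewise monotone, i.e. for each of them there are finitely many points $0=c_0<c_1<\dots<c_n=1$ such that its restriction to every $[c_i,c_{i+1}]$ is one-to-one. Assume that $f$ and $g$ strongly commute, i.e. $g\circ f^{-1}=f^{-1}\circ g$ as set-valued functions: $\{g(z): f(z)=x\}=\{y: f(y)=g(x)\}$ for every $x\in I$ (in particular $f\circ g=g\circ f$). For a set-valued function $F$ on a compact metric space $(X,d)$, an $n$-orbit is a tuple $(x_1,\dots,x_n)$ with $x_{i+1}\in F(x_i)$ for $1\le i<n$; a set of $n$-orbits is $(n,\varepsilon)$-separated if any two distinct members $(x_i),(y_i)$ satisfy $d(x_i,y_i)>\varepsilon$ for some $i$; $s_{n,\varepsilon}(F)$ is the largest cardinality of such a set; and $$\mathrm{Ent}(F)=\lim_{\varepsilon\to0}\limsup_{n\to\infty}\tfrac1n\log s_{n,\varepsilon}(F).$$ A map is regarded as a single-valued set-valued function. Then $$\mathrm{Ent}(g\circ f^{-1})=\max\{\mathrm{Ent}(f),\mathrm{Ent}(g)\}.$$ Moreover, let $\varprojlim(I,f)=\{(x_0,x_1,\dots)\in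 I^{\mathbb N}: f(x_{i+1})=x_i \text{ for all } i\ge 0\}$, with the metric $\sum_{i\ge0}|x_i-y_i|/2^i$, and let $\Psi\colon\varprojlim(I,f)\to\varprojlim(I,f)$ be the diagonal map $\Psi(x_0,x_1,x_2,\dots)=(g(x_1),g(x_2),\dots)$. Then also $$\mathrm{Ent}(\Psi)=\max\{\mathrm{Ent}(f),\mathrm{Ent}(g)\}.$$ -/

import Mathlib

open Filter Topology Set
open scoped ENNReal

noncomputable section

/-! ### Set-valued functions, their orbits and their entropy

A set-valued function on `X` is a function `F : X → Set X`. -/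

section Entropy

variable {X : Type*}

/-- `Orb_n(F)`: the set of all `n`-orbits `(x_1, …, x_n)` of `F`, that is `x_{i+1} ∈ F(x_i)` for
`1 ≤ i < n` (indices are shifted to start at `0`). -/
def orbits (F : X → Set X) (n : ℕ) : Set (Fin n → X) :=
  {x | ∀ i : ℕ, ∀ h : i + 1 < n, x ⟨i + 1, h⟩ ∈ F (x ⟨i, Nat.lt_of_succ_lt h⟩)}

variable [MetricSpace X]

/-- Any two distinct members of `S` are more than `ε` apart in some coordinate. -/
def IsOrbitSeparated {n : ℕ} (ε : ℝ) (S : Set (Fin n → X)) : Prop :=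
  S.Pairwise fun x y => ∃ i : Fin n, ε < dist (x i) (y i)

/-- `s_{n,ε}(F)`: the largest cardinality of an `(n, ε)`-separated set of `n`-orbits of `F`. -/
def sepCard (F : X → Set X) (n : ℕ) (ε : ℝ) : ℕ∞ :=
  ⨆ (S : Set (Fin n → X)) (_ : S ⊆ orbits F n ∧ IsOrbitSeparated ε S), S.encard

/-- `limsup_{n → ∞} (1/n) log s_{n,ε}(F)`. -/
def entropyAt (F : X → Set X) (ε : ℝ) : EReal :=
  limsup (fun n : ℕ => ENNReal.log (sepCard F n ε : ℝ≥0∞) / (n : EReal)) atTop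

/-- The topological entropy `Ent(F) = lim_{ε → 0} limsup_{n → ∞} (1/n) log s_{n,ε}(F)` of a
set-valued function. The limit is a supremum, because `entropyAt F ε` does not increase with `ε`;
see `tendsto_entropyAt`. -/
def setEntropy (F : X → Set X) : EReal :=
  ⨆ (ε : ℝ) (_ : 0 < ε), entropyAt F ε

/-- The topological entropy of a single-valued map, viewed as the set-valued function
`x ↦ {f x}`. -/
def mapEntropy (f : X → X) : EReal :=
  setEntropy fun x => {f x}

theorem sepCard_anti (F : X → Set X) (n : ℕ) : Antitone (sepCard F n) := by
  intro ε δ h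
  refine iSup₂_le fun S hS => ?_
  refine le_iSup₂_of_le S ⟨hS.1, fun x hx y hy hxy => ?_⟩ le_rfl
  obtain ⟨i, hi⟩ := hS.2 hx hy hxy
  exact ⟨i, h.trans_lt hi⟩

theorem entropyAt_anti (F : X → Set X) : Antitone (entropyAt F) := by
  intro ε δ h
  refine limsup_le_limsup (Eventually.of_forall fun n => ?_)
  refine EReal.div_le_div_right_of_nonneg (by positivity) (ENNReal.log_monotone ?_)
  exact_mod_cast sepCard_anti F n h

/-- The supremum in the definition of the entropy is the limit as `ε → 0⁺`. -/
theorem tendsto_entropyAt (F : X → Set X) :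
    Tendsto (entropyAt F) (𝓝[>] 0) (𝓝 (setEntropy F)) := by
  refine tendsto_order.2 ⟨fun a ha => ?_, fun a ha => ?_⟩
  · obtain ⟨ε, hε⟩ := lt_iSup_iff.1 ha
    obtain ⟨hpos, hε⟩ := lt_iSup_iff.1 hε
    filter_upwards [Ioo_mem_nhdsGT hpos] with δ hδ
    exact hε.trans_le (entropyAt_anti F hδ.2.le)
  · filter_upwards [self_mem_nhdsWithin] with δ hδ
    exact (le_iSup₂ (f := fun (ε : ℝ) (_ : 0 < ε) => entropyAt F ε) δ hδ).trans_lt ha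

end Entropy

/-! ### Strongly commuting maps -/

/-- The set-valued function `g ∘ f⁻¹`, `x ↦ {g z | f z = x}`. -/
def mapCompInv {X : Type*} (g f : X → X) : X → Set X :=
  fun x => g '' (f ⁻¹' {x})

/-- The set-valued function `f⁻¹ ∘ g`, `x ↦ {y | f y = g x}`. -/
def invCompMap {X : Type*} (f g : X → X) : X → Set X :=
  fun x => f ⁻¹' {g x}

/-- `f` and `g` strongly commute: `g ∘ f⁻¹ = f⁻¹ ∘ g`. -/
def StronglyCommuting {X : Type*} (f g : X → X) : Prop :=
  mapCompInv g f = invCompMap f g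

/-- Strongly commuting maps commute. -/
theorem StronglyCommuting.commute {X : Type*} {f g : X → X} (h : StronglyCommuting f g) (x : X) :
    f (g x) = g (f x) := by
  have h1 : g x ∈ mapCompInv g f (f x) := ⟨x, rfl, rfl⟩
  rw [h] at h1
  exact h1

/-- A self-map of `[0,1]` is piecewise monotone if there are `0 = c_0 < c_1 < ⋯ < c_n = 1` such
that it is one-to-one on every `[c_i, c_{i+1}]`. -/
def PiecewiseMonotone (f : unitInterval → unitInterval) : Prop :=
  ∃ (n : ℕ) (c : Fin (n + 1) → unitInterval), StrictMono c ∧ c 0 = 0 ∧ c (Fin.last n) = 1 ∧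
    ∀ i : Fin n, InjOn f (Icc (c i.castSucc) (c i.succ))

/-! ### The inverse limit of a single bonding map on `[0,1]` -/

/-- The inverse limit `{(x_0, x_1, …) | f(x_{i+1}) = x_i for all i}`. -/
def InverseLimit (f : unitInterval → unitInterval) : Type :=
  {x : ℕ → unitInterval // ∀ i, f (x (i + 1)) = x i}

namespace InverseLimit

variable {f : unitInterval → unitInterval}

theorem dist_le_one (a b : unitInterval) : dist a b ≤ 1 := by
  rw [Subtype.dist_eq, Real.dist_eq, abs_le]
  constructor <;> linarith [a.2.1, a.2.2, b.2.1, b.2.2]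

theorem term_le (x y : ℕ → unitInterval) (i : ℕ) : dist (x i) (y i) / 2 ^ i ≤ (1 / 2) ^ i := by
  rw [one_div, inv_pow, div_eq_mul_inv]
  exact mul_le_of_le_one_left (by positivity) (dist_le_one _ _)

theorem summable_term (x y : ℕ → unitInterval) : Summable fun i => dist (x i) (y i) / 2 ^ i :=
  Summable.of_nonneg_of_le (fun _ => by positivity) (term_le x y) summable_geometric_two

/-- The metric `d(x, y) = ∑ᵢ |x_i - y_i| / 2^i`. -/
instance : Dist (InverseLimit f) :=
  ⟨fun x y => ∑' i, dist (x.1 i) (y.1 i) / 2 ^ i⟩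

theorem dist_def (x y : InverseLimit f) : dist x y = ∑' i, dist (x.1 i) (y.1 i) / 2 ^ i := rfl

theorem term_le_dist (x y : InverseLimit f) (i : ℕ) : dist (x.1 i) (y.1 i) / 2 ^ i ≤ dist x y :=
  (summable_term x.1 y.1).le_tsum i fun _ _ => by positivity

instance : MetricSpace (InverseLimit f) where
  dist_self x := by simp [dist_def]
  dist_comm x y := by simp only [dist_def, dist_comm]
  dist_triangle x y z := by
    rw [dist_def, dist_def, dist_def, ← (summable_term x.1 y.1).tsum_add (summable_term y.1 z.1)]
    refine (summable_term x.1 z.1).tsum_le_tsum (fun i => ?_)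
      ((summable_term x.1 y.1).add (summable_term y.1 z.1))
    rw [← add_div]
    gcongr
    exact dist_triangle _ _ _
  eq_of_dist_eq_zero {x y} h := by
    refine Subtype.ext (funext fun i => dist_le_zero.1 ?_)
    have := term_le_dist x y i
    rw [h, div_le_iff₀ (by positivity), zero_mul] at this
    exact this

/-- The metric induces the product topology. -/
theorem isInducing_val : IsInducing (fun x : InverseLimit f => x.1) := by
  refine isInducing_iff_nhds.2 fun a => le_antisymm ?_ ?_
  · refine tendsto_iff_comap.1 (tendsto_pi_nhds.2 fun i => tendsto_iff_dist_tendsto_zero.2 ?_)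
    have h0 : Tendsto (fun x : InverseLimit f => 2 ^ i * dist x a) (𝓝 a) (𝓝 0) := by
      have := (tendsto_iff_dist_tendsto_zero.1 (tendsto_id (x := 𝓝 a))).const_mul ((2 : ℝ) ^ i)
      simpa using this
    refine squeeze_zero (fun _ => dist_nonneg) (fun x => ?_) h0
    have := term_le_dist x a i
    rwa [div_le_iff₀' (by positivity)] at this
  · have h1 : ∀ i, Tendsto (fun x : InverseLimit f => dist (x.1 i) (a.1 i) / 2 ^ i)
        (comap (fun x : InverseLimit f => x.1) (𝓝 a.1)) (𝓝 0) := fun i => by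
      have h2 := tendsto_iff_dist_tendsto_zero.1 ((tendsto_pi_nhds.1
        (tendsto_comap (f := fun x : InverseLimit f => x.1) (x := 𝓝 a.1))) i)
      simpa using h2.div_const ((2 : ℝ) ^ i)
    have h3 := tendsto_tsum_of_dominated_convergence summable_geometric_two h1
      (Eventually.of_forall fun x i => by
        rw [Real.norm_of_nonneg (by positivity)]
        exact term_le x.1 a.1 i)
    rw [tsum_zero] at h3
    have h4 : Tendsto (fun x : InverseLimit f => x) (comap (fun x : InverseLimit f => x.1) (𝓝 a.1))
        (𝓝 a) := tendsto_iff_dist_tendsto_zero.2 h3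
    exact h4

end InverseLimit

/-- The diagonal map `(x_0, x_1, x_2, …) ↦ (g(x_1), g(x_2), …)` induced by `g` on the inverse limit
of `f`, where `f` and `g` commute. -/
def diagonalMap (f g : unitInterval → unitInterval) (h : ∀ x, f (g x) = g (f x)) :
    InverseLimit f → InverseLimit f :=
  fun x => ⟨fun i => g (x.1 (i + 1)), fun i => by rw [h, x.2 (i + 1)]⟩

end

/-! Let c_n(f) be the largest cardinality of a fibre of f^n. Every entropy in the theorem is
expressed through the exponential growth rates of c_n(f) and c_n(g). Taking f = id in the formula
for g ∘ f⁻¹ gives Ent(g) = rate of c_n(g).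

Upper bound. By strong commutation an orbit of g ∘ f⁻¹ comes from a single point z, as (f^n z,
f^(n-1) g z, …, g^n z). If two such points have ε-separated orbits, the intermediate value theorem
puts between them a point that some f^(n-i) g^i sends into a fixed finite grid. There are at most
const · Σ_i c_(n-i)(f) c_i(g) of these. At finite precision an orbit of Ψ is also governed by one
coordinate, so the same count applies.

Lower bound. Fix N. G = g^N maps each fibre of Φ = f^N onto a fibre of Φ, so fibre sizes only drop
along G-orbits, and points can merge under G inside a fibre of Φ only when the size drops. If w is
labelled by the itinerary of its orbit through the laps of g, then G w and the label determine Φ w.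
Hence a G^m-fibre with prescribed labels has at most 2^B points, with B = c_N(f) independent of m
(`fiberSup_le_of_label`). A small ball meets at most three laps, so there are at most 3^(N+1) ·
s_(N+1,δ) labels. This gives rate(g) ≤ Ent(g ∘ f⁻¹) + log 3, and passing to iterates f^k, g^k
removes log 3. Reversing orbits exchanges f and g.

For Ψ the lower bound is applied on the core ⋂ f^k(I), since exactly the points of the core occur as
coordinates in the inverse limit. No growth is lost there (`fiberGrowth_le_restrict_core`): outside
the core, but inside a late image of f, a map commuting with f adds at most a linear number of terms
to the fibre count. -/

noncomputable section

/-! ### Exponential rates -/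

section Rates

open ExpGrowth
open scoped NNReal

/-- `u n` is eventually at most a constant times `a ^ n`. -/
def HasRate (u : ℕ → ℝ≥0∞) (a : ℝ≥0) : Prop :=
  ∃ C : ℝ≥0, ∀ᶠ n in atTop, u n ≤ C * (a : ℝ≥0∞) ^ n

theorem HasRate.exists_forall_le {u : ℕ → ℝ≥0∞} {a : ℝ≥0} (h : HasRate u a)
    (hu : ∀ n, u n ≠ ⊤) (ha : 1 ≤ a) : ∃ C : ℝ≥0, ∀ n, u n ≤ C * (a : ℝ≥0∞) ^ n := by
  obtain ⟨C, hC⟩ := h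
  obtain ⟨N, hN⟩ := eventually_atTop.1 hC
  refine ⟨C + ∑ i ∈ Finset.range N, (u i).toNNReal, fun n => ?_⟩
  rcases le_or_gt N n with h | h
  · refine (hN n h).trans ?_
    gcongr
    exact le_self_add
  · have h1 : (u n).toNNReal ≤ C + ∑ i ∈ Finset.range N, (u i).toNNReal :=
      (Finset.single_le_sum (f := fun i => (u i).toNNReal) (fun _ _ => zero_le)
        (Finset.mem_range.2 h)).trans le_add_self
    calc u n = ((u n).toNNReal : ℝ≥0∞) * 1 := by rw [mul_one, ENNReal.coe_toNNReal (hu n)]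
      _ ≤ _ := by
        gcongr
        exact_mod_cast one_le_pow_of_one_le' ha n

theorem hasRate_of_expGrowthSup_lt {u : ℕ → ℝ≥0∞} {a : ℝ≥0}
    (h : expGrowthSup u < ENNReal.log a) : HasRate u a := by
  refine ⟨1, ?_⟩
  have h1 : expGrowthSup u < expGrowthSup fun n => (a : ℝ≥0∞) ^ n := by
    rwa [expGrowthSup_pow]
  filter_upwards [eventually_le_exp h] with n hn
  refine hn.trans (le_of_eq ?_)
  rw [ENNReal.coe_one, one_mul, mul_comm, ← ENNReal.log_pow, ENNReal.exp_log]

theorem HasRate.expGrowthSup_le {u : ℕ → ℝ≥0∞} {a : ℝ≥0} (h : HasRate u a) :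
    expGrowthSup u ≤ ENNReal.log a := by
  obtain ⟨C, hC⟩ := h
  rw [← expGrowthSup_pow]
  exact expGrowthSup_le_of_eventually_le ENNReal.coe_ne_top hC

theorem exists_log_between {s t : EReal} (hs : 0 ≤ s) (h : s < t) :
    ∃ a : ℝ≥0, 1 ≤ a ∧ s < ENNReal.log a ∧ ENNReal.log a < t := by
  obtain ⟨r, hr, hr'⟩ := exists_between h
  obtain ⟨a, rfl⟩ := ENNReal.log_surjective r
  lift a to ℝ≥0 using by
    rintro rfl
    simp at hr'
  refine ⟨a, ?_, hr, hr'⟩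
  exact_mod_cast ENNReal.zero_le_log_iff.1 (hs.trans hr.le)

/-- The gap between `a` and `b` leaves room for the losses met later: a factor linear in n, or the
factor 3 from the colourings. -/
theorem expGrowthSup_le_of_forall_hasRate {u : ℕ → ℝ≥0∞} {h : EReal} (h0 : 0 ≤ h)
    (H : ∀ a b : ℝ≥0, 1 ≤ a → a < b → h < ENNReal.log a → HasRate u b) :
    expGrowthSup u ≤ h := by
  refine le_of_forall_gt_imp_ge_of_dense fun t ht => ?_
  obtain ⟨b, hb1, hb, hbt⟩ := exists_log_between h0 ht
  obtain ⟨a, ha1, ha, hab⟩ := exists_log_between h0 hb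
  have : a < b := by exact_mod_cast ENNReal.log_lt_log_iff.1 hab
  exact (H a b ha1 this ha).expGrowthSup_le.trans hbt.le

theorem exists_linear_mul_pow_le {a b : ℝ≥0} (ha : 1 ≤ a) (hab : a < b) :
    ∃ C : ℝ≥0, ∀ n : ℕ, ((n : ℝ≥0∞) + 1) * (a : ℝ≥0∞) ^ n ≤ C * (b : ℝ≥0∞) ^ n := by
  have ha0 : (0 : ℝ) < a := by exact_mod_cast zero_lt_one.trans_le ha
  set r : ℝ := b / a with hr
  have hr1 : 0 < r - 1 := by
    rw [hr, sub_pos, one_lt_div ha0]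
    exact_mod_cast hab
  -- Bernoulli gives r^n ≥ 1 + n(r - 1), and this constant times that is at least n + 1.
  obtain ⟨C, hC⟩ : ∃ C : ℝ≥0, (C : ℝ) = 1 + 1 / (r - 1) := ⟨⟨_, by positivity⟩, rfl⟩
  refine ⟨C, fun n => ?_⟩
  have key : ((n : ℝ) + 1) * (a : ℝ) ^ n ≤ (1 + 1 / (r - 1)) * (b : ℝ) ^ n := by
    have hb : (b : ℝ) = r * a := by rw [hr, div_mul_cancel₀ _ ha0.ne']
    have h2 : 1 + (n : ℝ) * (r - 1) ≤ r ^ n := by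
      have := one_add_mul_le_pow (a := r - 1) (by linarith) n
      simpa using this
    rw [hb, mul_pow, ← mul_assoc]
    gcongr
    calc (n : ℝ) + 1 ≤ (1 + 1 / (r - 1)) * (1 + n * (r - 1)) := by
          have : (1 + 1 / (r - 1)) * (1 + n * (r - 1)) = 1 + n * (r - 1) + 1 / (r - 1) + n := by
            field_simp
            ring
          rw [this]
          have : 0 ≤ n * (r - 1) + 1 / (r - 1) := by positivity
          linarith
      _ ≤ _ := by gcongr
  have key' : ((n : ℝ≥0) + 1) * a ^ n ≤ C * b ^ n := by
    rw [← NNReal.coe_le_coe]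
    push_cast
    rwa [hC]
  have := ENNReal.coe_le_coe.2 key'
  push_cast at this
  exact this

end Rates

/-! ### Counting -/

section Counting

theorem encard_le_encard_mul_of_fibers {A B : Type*} {s : Set A} {t : Set B} (φ : A → B)
    (h : MapsTo φ s t) (c : ℕ∞) (hc : ∀ b ∈ t, (s ∩ φ ⁻¹' {b}).encard ≤ c) :
    s.encard ≤ t.encard * c := by
  rcases t.finite_or_infinite with ht | ht
  · have h1 : s ⊆ ⋃ b ∈ ht.toFinset, s ∩ φ ⁻¹' {b} := fun x hx => by
      simp only [mem_iUnion]
      exact ⟨φ x, by simpa using h hx, hx, rfl⟩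
    refine (encard_le_encard h1).trans ((Finset.set_encard_biUnion_le _ _).trans ?_)
    refine (Finset.sum_le_card_nsmul _ _ c fun b hb => hc b (by simpa using hb)).trans ?_
    rw [nsmul_eq_mul, ht.encard_eq_coe_toFinset_card]
  · rcases eq_or_ne c 0 with rfl | hc0
    · rcases s.eq_empty_or_nonempty with rfl | ⟨x, hx⟩
      · simp
      · have := hc _ (h hx)
        rw [nonpos_iff_eq_zero, encard_eq_zero] at this
        exact absurd (show x ∈ s ∩ φ ⁻¹' {φ x} from ⟨hx, rfl⟩) (this ▸ notMem_empty _)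
    · rw [ht.encard_eq, ENat.top_mul hc0]
      exact le_top

variable {X : Type*}

/-- The largest cardinality of a fibre of the `n`-th iterate of `f`. -/
def fiberSup (f : X → X) (n : ℕ) : ℕ∞ := ⨆ y, (f^[n] ⁻¹' {y}).encard

/-- The exponential growth rate of the cardinalities of the fibres of the iterates of `f`. -/
def fiberGrowth (f : X → X) : EReal := ExpGrowth.expGrowthSup fun n => (fiberSup f n : ℝ≥0∞)

theorem encard_fiber_le (f : X → X) (n : ℕ) (y : X) : (f^[n] ⁻¹' {y}).encard ≤ fiberSup f n :=
  le_iSup (fun y => (f^[n] ⁻¹' {y}).encard) y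

theorem fiberSup_add_le (f : X → X) (m n : ℕ) :
    fiberSup f (m + n) ≤ fiberSup f m * fiberSup f n := by
  refine iSup_le fun y => ?_
  refine (encard_le_encard_mul_of_fibers (t := f^[m] ⁻¹' {y}) f^[n] (fun x hx => ?_) (fiberSup f n)
    fun b _ => ?_).trans (mul_le_mul_left (encard_fiber_le f m y) _)
  · rwa [mem_preimage, ← Function.iterate_add_apply]
  · exact (encard_le_encard inter_subset_right).trans (encard_fiber_le f n b)

theorem fiberSup_iterate (f : X → X) (k n : ℕ) : fiberSup f^[k] n = fiberSup f (k * n) := by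
  simp only [fiberSup, Function.iterate_mul]

theorem fiberSup_zero_le (f : X → X) : fiberSup f 0 ≤ 1 :=
  iSup_le fun y => by
    have : (f^[0] ⁻¹' {y}) = {y} := rfl
    rw [this, encard_singleton]

theorem fiberSup_ne_top {f : X → X} (h : fiberSup f 1 ≠ ⊤) (n : ℕ) : fiberSup f n ≠ ⊤ := by
  induction n with
  | zero => exact ((fiberSup_zero_le f).trans_lt (ENat.natCast_lt_top 1)).ne
  | succ n ih =>
    exact ((fiberSup_add_le f n 1).trans_lt
      (WithTop.mul_lt_top (lt_top_iff_ne_top.2 ih) (lt_top_iff_ne_top.2 h))).ne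

theorem one_le_fiberSup [Nonempty X] (f : X → X) (n : ℕ) : 1 ≤ fiberSup f n := by
  obtain ⟨x⟩ := ‹Nonempty X›
  refine le_trans ?_ (encard_fiber_le f n (f^[n] x))
  exact one_le_encard_iff_nonempty.2 ⟨x, rfl⟩

theorem fiberGrowth_nonneg [Nonempty X] (f : X → X) : 0 ≤ fiberGrowth f := by
  have h := ExpGrowth.expGrowthSup_monotone
    (show (fun _ : ℕ => (1 : ℝ≥0∞)) ≤ fun n => (fiberSup f n : ℝ≥0∞) from fun n => by
      simpa using ENat.toENNReal_mono (one_le_fiberSup f n))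
  rwa [ExpGrowth.expGrowthSup_const one_ne_zero ENNReal.one_ne_top] at h

theorem fiberGrowth_id_le (X : Type*) : fiberGrowth (id : X → X) ≤ 0 := by
  have h := ExpGrowth.expGrowthSup_monotone
    (show (fun n => (fiberSup (id : X → X) n : ℝ≥0∞)) ≤ fun _ : ℕ => (1 : ℝ≥0∞) from fun n => by
      have : fiberSup (id : X → X) n ≤ 1 := iSup_le fun y => by
        rw [Function.iterate_id, preimage_id, encard_singleton]
      simpa using ENat.toENNReal_mono this)
  rwa [ExpGrowth.expGrowthSup_const one_ne_zero ENNReal.one_ne_top] at h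

end Counting

/-! ### Strong commutation and orbits -/

section Commuting

variable {X : Type*}

theorem stronglyCommuting_iff {f g : X → X} : StronglyCommuting f g ↔
    (∀ x, f (g x) = g (f x)) ∧ ∀ x y, f y = g x → ∃ z, f z = x ∧ g z = y := by
  refine ⟨fun h => ⟨h.commute, fun x y hxy => ?_⟩, fun h => ?_⟩
  · have h1 : y ∈ invCompMap f g x := hxy
    rwa [← h] at h1
  · refine funext fun x => Set.ext fun y => ⟨?_, fun hy => h.2 x y hy⟩
    rintro ⟨z, rfl, rfl⟩
    exact h.1 z

namespace StronglyCommuting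

variable {f f' g : X → X}

theorem exists_lift (h : StronglyCommuting f g) {x y : X} (hxy : f y = g x) :
    ∃ z, f z = x ∧ g z = y :=
  (stronglyCommuting_iff.1 h).2 x y hxy

protected theorem symm (h : StronglyCommuting f g) : StronglyCommuting g f :=
  stronglyCommuting_iff.2 ⟨fun x => (h.commute x).symm, fun _ _ hxy =>
    (h.exists_lift hxy.symm).imp fun _ => And.symm⟩

theorem id_left (g : X → X) : StronglyCommuting id g :=
  stronglyCommuting_iff.2 ⟨fun _ => rfl, fun x _ hxy => ⟨x, rfl, hxy.symm⟩⟩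

theorem comp_left (h : StronglyCommuting f g) (h' : StronglyCommuting f' g) :
    StronglyCommuting (f ∘ f') g := by
  refine stronglyCommuting_iff.2 ⟨fun x => ?_, fun x y hxy => ?_⟩
  · simp only [Function.comp_apply, h'.commute, h.commute]
  · obtain ⟨z, rfl, hz⟩ := h.exists_lift hxy
    obtain ⟨w, rfl, rfl⟩ := h'.exists_lift hz.symm
    exact ⟨w, rfl, rfl⟩

theorem iterate_left (h : StronglyCommuting f g) (n : ℕ) : StronglyCommuting f^[n] g := by
  induction n with
  | zero => exact id_left g
  | succ n ih => exact ih.comp_left h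

theorem iterate (h : StronglyCommuting f g) (m n : ℕ) : StronglyCommuting f^[m] g^[n] :=
  (h.symm.iterate_left n).symm.iterate_left m

/-- The `n`-orbits of `g ∘ f⁻¹` are the tuples `(f^n z, f^{n-1} g z, …, g^n z)`. -/
theorem mem_orbits_iff (h : StronglyCommuting f g) {n : ℕ} {x : Fin (n + 1) → X} :
    x ∈ orbits (mapCompInv g f) (n + 1) ↔ ∃ z, ∀ i : Fin (n + 1), x i = f^[n - i] (g^[i] z) := by
  constructor
  · induction n with
    | zero =>
      refine fun _ => ⟨x 0, fun i => ?_⟩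
      rw [Fin.fin_one_eq_zero i]
      rfl
    | succ n ih =>
      intro hx
      obtain ⟨z, hz⟩ := ih (x := fun i => x i.castSucc) fun i hi => hx i (by omega)
      have hlast : f (x (Fin.last _)) = g^[n + 1] z := by
        obtain ⟨w, hw, hw'⟩ := hx n (Nat.lt_succ_self _)
        have h1 : x ⟨n, by omega⟩ = g^[n] z := by
          have := hz (Fin.last n)
          rw [Fin.val_last, Nat.sub_self] at this
          exact this
        have h2 : f w = g^[n] z := by rw [← h1]; exact hw
        rw [Function.iterate_succ_apply', ← h2, ← h.commute, hw']
        rfl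
      -- Pull the parameter z of the shorter orbit back through f, choosing the preimage that
      -- g^(n+1) sends to the new last entry.
      obtain ⟨w, rfl, hw⟩ := (h.iterate 1 (n + 1)).exists_lift hlast
      refine ⟨w, Fin.lastCases ?_ fun i => ?_⟩
      · simp [hw]
      · have h3 : n + 1 - (i : ℕ) = n - i + 1 := by omega
        rw [hz i, Fin.val_castSucc, h3, Function.iterate_succ_apply]
        exact congrArg _ ((h.iterate 1 i).commute w).symm
  · rintro ⟨z, hz⟩ i hi
    refine ⟨f^[n - (i + 1)] (g^[i] z), ?_, ?_⟩
    · have h3 : n - i = n - (i + 1) + 1 := by omega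
      rw [mem_preimage, mem_singleton_iff, hz]
      simp only [h3, Function.iterate_succ_apply']
    · rw [hz]
      simp only [Function.iterate_succ_apply']
      exact ((h.iterate (n - (i + 1)) 1).commute _).symm

end StronglyCommuting

theorem mapCompInv_id (g : X → X) : mapCompInv g id = fun x => {g x} := by
  funext x
  simp [mapCompInv]

end Commuting

/-! ### Growth of fibres is bounded by the entropy -/

section FiberGrowth

open scoped NNReal

variable {X : Type*}

/-- Submultiplicativity: divide n by k with remainder; the finitely many remainders go into the
constant. -/
theorem hasRate_fiberSup_of_multiples {g : X → X} (hg : fiberSup g 1 ≠ ⊤) {k : ℕ} (hk : 0 < k)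
    {b : ℝ≥0} (hb : 1 ≤ b) {C : ℝ≥0}
    (h : ∀ m, (fiberSup g (k * m) : ℝ≥0∞) ≤ C * (b : ℝ≥0∞) ^ (k * m)) :
    HasRate (fun n => (fiberSup g n : ℝ≥0∞)) b := by
  have hfin : ∀ n, (fiberSup g n : ℝ≥0∞) ≠ ⊤ := fun n => by
    simpa using fiberSup_ne_top hg n
  refine ⟨C * ∑ i ∈ Finset.range k, (fiberSup g i : ℝ≥0∞).toNNReal, Eventually.of_forall fun n => ?_⟩
  have h1 : (fiberSup g (n % k) : ℝ≥0∞).toNNReal ≤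
      ∑ i ∈ Finset.range k, (fiberSup g i : ℝ≥0∞).toNNReal :=
    Finset.single_le_sum (f := fun i => (fiberSup g i : ℝ≥0∞).toNNReal) (fun _ _ => zero_le)
      (Finset.mem_range.2 (Nat.mod_lt _ hk))
  calc (fiberSup g n : ℝ≥0∞) = fiberSup g (k * (n / k) + n % k) := by rw [Nat.div_add_mod]
    _ ≤ fiberSup g (k * (n / k)) * fiberSup g (n % k) := by
        rw [← ENat.toENNReal_mul]
        exact ENat.toENNReal_mono (fiberSup_add_le _ _ _)
    _ ≤ (C * (b : ℝ≥0∞) ^ n) * ((fiberSup g (n % k) : ℝ≥0∞).toNNReal : ℝ≥0∞) := by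
        rw [ENNReal.coe_toNNReal (hfin _)]
        gcongr
        refine (h _).trans ?_
        gcongr
        · exact_mod_cast hb
        · exact Nat.mul_div_le n k
    _ ≤ (C * (b : ℝ≥0∞) ^ n) *
          ((∑ i ∈ Finset.range k, (fiberSup g i : ℝ≥0∞).toNNReal : ℝ≥0) : ℝ≥0∞) := by
        gcongr
    _ = _ := by
        rw [ENNReal.coe_mul]
        ring

/-- The common fibres of strongly commuting maps are small unless the cardinality of the fibres of
`Φ` drops. -/
theorem encard_common_fiber_le {Φ G : X → X} (h : StronglyCommuting Φ G)
    (hfin : ∀ x, (Φ ⁻¹' {x}).Finite) (x y : X) :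
    (Φ ⁻¹' {G x}).ncard ≤ (Φ ⁻¹' {x}).ncard ∧ {w | Φ w = x ∧ G w = y}.encard ≤
      2 ^ ((Φ ⁻¹' {x}).ncard - (Φ ⁻¹' {G x}).ncard) := by
  have himg : Φ ⁻¹' {G x} ⊆ G '' (Φ ⁻¹' {x}) := fun v hv => h.exists_lift hv
  set W := {w | Φ w = x ∧ G w = y} with hW
  have hWs : W ⊆ Φ ⁻¹' {x} := fun w hw => hw.1
  have hle : (Φ ⁻¹' {G x}).ncard ≤ (Φ ⁻¹' {x}).ncard :=
    (ncard_le_ncard himg ((hfin x).image G)).trans (ncard_image_le (hfin x))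
  refine ⟨hle, ?_⟩
  have himg2 : Φ ⁻¹' {G x} ⊆ insert y (G '' (Φ ⁻¹' {x} \ W)) := fun v hv => by
    obtain ⟨w, hw, rfl⟩ := himg hv
    by_cases hwW : w ∈ W
    · exact Or.inl hwW.2
    · exact Or.inr ⟨w, ⟨hw, hwW⟩, rfl⟩
  -- All of `W` collapses to the single point y, which costs |W| - 1 points of the image.
  have h1 : (Φ ⁻¹' {G x}).ncard ≤ (Φ ⁻¹' {x}).ncard - W.ncard + 1 := by
    have hf : (Φ ⁻¹' {x} \ W).Finite := (hfin x).sdiff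
    refine (ncard_le_ncard himg2 ((hf.image G).insert y)).trans ((ncard_insert_le _ _).trans ?_)
    gcongr
    rw [← ncard_sdiff hWs ((hfin x).subset hWs)]
    exact ncard_image_le hf
  have h2 : W.ncard ≤ (Φ ⁻¹' {x}).ncard := ncard_le_ncard hWs (hfin x)
  rw [← ((hfin x).subset hWs).cast_ncard_eq]
  -- The bound d + 1 is weakened to 2^d so that the bounds telescope when multiplied along an orbit.
  have h3 : W.ncard ≤ 2 ^ ((Φ ⁻¹' {x}).ncard - (Φ ⁻¹' {G x}).ncard) := by
    have := Nat.lt_two_pow_self (n := (Φ ⁻¹' {x}).ncard - (Φ ⁻¹' {G x}).ncard)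
    omega
  exact_mod_cast h3

/-- Suppose that `G w` and the label of `w` determine `Φ w`. Then there are boundedly many points
with given labels along the `G`-orbit and given end point. -/
theorem encard_labelled_fiber_le {Λ : Type*} {Φ G : X → X} (h : StronglyCommuting Φ G) {B : ℕ}
    (hB : ∀ x, (Φ ⁻¹' {x}).encard ≤ B) {l : X → Λ}
    (hl : ∀ w w', l w = l w' → G w = G w' → Φ w = Φ w') (I : ℕ → Λ) (m : ℕ) (y : X) :
    {z | G^[m] z = y ∧ ∀ j < m, l (G^[j] z) = I j}.encard ≤
      2 ^ (B - (Φ ⁻¹' {Φ y}).ncard) := by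
  have hfin : ∀ x, (Φ ⁻¹' {x}).Finite := fun x => finite_of_encard_le_coe (hB x)
  have hB' : ∀ x, (Φ ⁻¹' {x}).ncard ≤ B := fun x => (encard_le_coe_iff_finite_ncard_le.1 (hB x)).2
  induction m generalizing y with
  | zero =>
    have : {z | G^[0] z = y ∧ ∀ j < 0, l (G^[j] z) = I j} = {y} := by
      ext z
      simp
    rw [this, encard_singleton]
    exact one_le_pow₀ (by norm_num)
  | succ m ih =>
    set S := {z | G^[m + 1] z = y ∧ ∀ j < m + 1, l (G^[j] z) = I j}
    set W := {w | G w = y ∧ l w = I m} with hW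
    have hmaps : MapsTo G^[m] S W := fun z hz =>
      ⟨by rw [← Function.iterate_succ_apply' G]; exact hz.1, hz.2 m (Nat.lt_succ_self m)⟩
    rcases W.eq_empty_or_nonempty with hWe | ⟨w₀, hw₀⟩
    · have : S = ∅ := eq_empty_of_forall_notMem fun z hz => by
        have := hmaps hz
        rw [hWe] at this
        exact this
      simp [this]
    have hΦ : ∀ w ∈ W, Φ w = Φ w₀ := fun w hw =>
      hl w w₀ (hw.2.trans hw₀.2.symm) (hw.1.trans hw₀.1.symm)
    have hy : Φ y = G (Φ w₀) := by rw [← hw₀.1, h.commute]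
    obtain ⟨h1, h2⟩ := encard_common_fiber_le h hfin (Φ w₀) y
    have hWc : W.encard ≤ 2 ^ ((Φ ⁻¹' {Φ w₀}).ncard - (Φ ⁻¹' {G (Φ w₀)}).ncard) :=
      (encard_le_encard fun w hw => (⟨hΦ w hw, hw.1⟩ : Φ w = Φ w₀ ∧ G w = y)).trans h2
    refine (encard_le_encard_mul_of_fibers G^[m] hmaps (2 ^ (B - (Φ ⁻¹' {Φ w₀}).ncard))
      fun w hw => ?_).trans ?_
    · rw [← hΦ w hw]
      exact (encard_le_encard fun z hz =>
        (⟨hz.2, fun j hj => hz.1.2 j (hj.trans (Nat.lt_succ_self m))⟩ :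
          G^[m] z = w ∧ ∀ j < m, l (G^[j] z) = I j)).trans (ih w)
    -- With x = Φ w₀ and c the size of Φ-fibres, G x = Φ y and 2^(c(x) - c(Φ y)) · 2^(B - c(x)) =
    -- 2^(B - c(Φ y)).
    · refine (mul_le_mul_left hWc _).trans ?_
      rw [← pow_add, hy]
      have := hB' (Φ w₀)
      refine pow_le_pow_right₀ (by norm_num) ?_
      omega

theorem fiberSup_le_of_label {Λ : Type*} {Φ G : X → X} (h : StronglyCommuting Φ G) {B : ℕ}
    (hB : ∀ x, (Φ ⁻¹' {x}).encard ≤ B) {l : X → Λ}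
    (hl : ∀ w w', l w = l w' → G w = G w' → Φ w = Φ w') (m : ℕ) :
    fiberSup G m ≤ (range l).encard ^ m * 2 ^ B := by
  refine iSup_le fun y => ?_
  refine (encard_le_encard_mul_of_fibers (t := univ.pi fun _ : Fin m => range l)
    (fun z (j : Fin m) => l (G^[j] z)) (fun z _ j _ => mem_range_self _) (2 ^ B)
    fun I _ => ?_).trans (le_of_eq ?_)
  · rcases (G^[m] ⁻¹' {y} ∩ (fun z (j : Fin m) => l (G^[j] z)) ⁻¹' {I}).eq_empty_or_nonempty
      with he | ⟨z₀, hz₀⟩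
    · simp [he]
    refine (encard_le_encard fun z hz => ?_).trans
      ((encard_labelled_fiber_le h hB hl (fun j => l (G^[j] z₀)) m y).trans
        (pow_le_pow_right₀ (by norm_num) (Nat.sub_le _ _)))
    exact ⟨hz.1, fun j hj => congrFun (hz.2.trans hz₀.2.symm) ⟨j, hj⟩⟩
  · rw [encard_pi_eq_prod_encard]
    simp

/-! ### Fine colourings and the lower bound for the entropy -/

variable [MetricSpace X]

/-- A colouring such that `g` is injective on every colour and such that every ball of radius `δ`
meets at most three colours. -/
structure IsFineColoring {ι : Type*} (g : X → X) (κ : X → ι) (δ : ℝ) : Prop where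
  pos : 0 < δ
  injective : ∀ x y, κ x = κ y → g x = g y → x = y
  local_le : ∀ x, ∃ τ : X → Fin 3, ∀ y z, dist x y ≤ δ → dist x z ≤ δ → τ y = τ z → κ y = κ z

/-- A maximal separated set spans. The maximum with 0 covers negative δ. -/
theorem exists_spanning (F : X → Set X) (n : ℕ) (δ : ℝ) :
    ∃ E ⊆ orbits F n, E.encard ≤ sepCard F n δ ∧
      ∀ x ∈ orbits F n, ∃ e ∈ E, ∀ i, dist (e i) (x i) ≤ max δ 0 := by
  obtain ⟨E, hE⟩ := zorn_subset {S : Set (Fin n → X) | S ⊆ orbits F n ∧ IsOrbitSeparated δ S}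
    fun c hc hchain => ⟨⋃₀ c, ⟨sUnion_subset fun s hs => (hc hs).1,
      (pairwise_sUnion hchain.directedOn).2 fun s hs => (hc hs).2⟩, fun s hs =>
        subset_sUnion_of_mem hs⟩
  refine ⟨E, hE.prop.1, le_iSup₂_of_le E hE.prop le_rfl, fun x hx => ?_⟩
  by_contra! hcon
  have hmem : insert x E ∈ {S : Set (Fin n → X) | S ⊆ orbits F n ∧ IsOrbitSeparated δ S} := by
    refine ⟨insert_subset hx hE.prop.1, (pairwise_insert.2 ⟨hE.prop.2, fun e he _ => ?_⟩)⟩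
    obtain ⟨i, hi⟩ := hcon e he
    have hi := (le_max_left _ _).trans_lt hi
    exact ⟨⟨i, by rwa [dist_comm]⟩, ⟨i, hi⟩⟩
  have hxE : x ∈ E := hE.le_of_ge hmem (subset_insert x E) (mem_insert x E)
  obtain ⟨i, hi⟩ := hcon x hxE
  rw [dist_self] at hi
  exact (le_max_right δ 0).not_gt hi

/-- Each orbit is shadowed by some e in a δ-spanning set; once e is fixed, every entry has at most
three possible colours. -/
theorem IsFineColoring.encard_itineraries_le {ι : Type*} {g : X → X} {κ : X → ι} {δ : ℝ}
    (h : IsFineColoring g κ δ) (F : X → Set X) (n : ℕ) :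
    ((fun x : Fin n → X => κ ∘ x) '' orbits F n).encard ≤ sepCard F n δ * 3 ^ n := by
  obtain ⟨E, -, hEc, hE⟩ := exists_spanning F n δ
  rw [max_eq_left h.pos.le] at hE
  choose τ hτ using h.local_le
  rcases (orbits F n).eq_empty_or_nonempty with he | hne
  · simp [he]
  obtain ⟨x₀, hx₀⟩ := hne
  have hsel : ∀ t : Fin n → ι, ∃ p : (Fin n → X) × (Fin n → X),
      t ∈ (fun x : Fin n → X => κ ∘ x) '' orbits F n →
        κ ∘ p.1 = t ∧ p.2 ∈ E ∧ ∀ i, dist (p.2 i) (p.1 i) ≤ δ := fun t => by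
    by_cases ht : t ∈ (fun x : Fin n → X => κ ∘ x) '' orbits F n
    · obtain ⟨x, hx, rfl⟩ := ht
      obtain ⟨e, he, hd⟩ := hE x hx
      exact ⟨(x, e), fun _ => ⟨rfl, he, hd⟩⟩
    · exact ⟨(x₀, x₀), fun h => absurd h ht⟩
  choose p hp using hsel
  refine (encard_le_encard_mul_of_fibers (t := E) (fun t => (p t).2) (fun t ht => (hp t ht).2.1)
    (3 ^ n) fun e _ => ?_).trans (mul_le_mul_left hEc _)
  refine (encard_le_encard_of_injOn (t := univ)
    (f := fun t => fun i => τ (e i) ((p t).1 i)) (mapsTo_univ _ _) ?_).trans (le_of_eq ?_)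
  · rintro t ⟨ht, rfl⟩ s ⟨hs, hse⟩ hts
    obtain ⟨ht1, -, ht3⟩ := hp t ht
    obtain ⟨hs1, -, hs3⟩ := hp s hs
    rw [← ht1, ← hs1]
    funext i
    have hse : (p s).2 = (p t).2 := hse
    rw [hse] at hs3
    exact hτ ((p t).2 i) _ _ (ht3 i) (hs3 i) (congrFun hts i)
  · rw [encard_univ, ENat.card_eq_coe_fintype_card]
    simp

variable {f g : X → X}

theorem IsFineColoring.fiberSup_mul_le {ι : Type*} {κ : X → ι} {δ : ℝ} (h : IsFineColoring g κ δ)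
    (hfg : StronglyCommuting f g) {N B : ℕ} (hB : fiberSup f N ≤ B) (m : ℕ) :
    fiberSup g (N * m) ≤ (sepCard (mapCompInv g f) (N + 1) δ * 3 ^ (N + 1)) ^ m * 2 ^ B := by
  have hl : ∀ w w' : X, (fun i : Fin (N + 1) => κ (f^[N - i] (g^[i] w))) =
      (fun i : Fin (N + 1) => κ (f^[N - i] (g^[i] w'))) → g^[N] w = g^[N] w' →
      f^[N] w = f^[N] w' := by
    intro w w' hκ hG
    -- Walk back along the orbit from g^N w to f^N w: the f-image of the known entry is the g-image
    -- of the preceding one, and the colour selects the right g-preimage.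
    have key : ∀ j ≤ N, f^[j] (g^[N - j] w) = f^[j] (g^[N - j] w') := by
      intro j
      induction j with
      | zero => exact fun _ => hG
      | succ j ih =>
        intro hj
        have hκ' := congrFun hκ ⟨N - (j + 1), by omega⟩
        simp only [show N - (N - (j + 1)) = j + 1 by omega] at hκ'
        refine h.injective _ _ hκ' ?_
        have e : ∀ v, g (f^[j + 1] (g^[N - (j + 1)] v)) = f (f^[j] (g^[N - j] v)) := fun v => by
          rw [← (hfg.iterate_left (j + 1)).commute, ← Function.iterate_succ_apply' g,
            show (N - (j + 1)).succ = N - j by omega, Function.iterate_succ_apply']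
        rw [e, e, ih (by omega)]
    simpa using key N le_rfl
  rw [← fiberSup_iterate]
  refine (fiberSup_le_of_label (hfg.iterate N N)
    (fun x => (encard_fiber_le f N x).trans hB) hl m).trans ?_
  gcongr
  refine (encard_le_encard ?_).trans (h.encard_itineraries_le (mapCompInv g f) (N + 1))
  rintro _ ⟨w, rfl⟩
  exact ⟨fun i => f^[N - i] (g^[i] w), hfg.mem_orbits_iff.2 ⟨w, fun _ => rfl⟩, rfl⟩

theorem IsFineColoring.hasRate_fiberSup {ι : Type*} {κ : X → ι} {δ : ℝ} (h : IsFineColoring g κ δ)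
    (hfg : StronglyCommuting f g) (hf : fiberSup f 1 ≠ ⊤) (hg : fiberSup g 1 ≠ ⊤)
    {A b : ℝ≥0} (hA : 1 ≤ A) (hb : 3 * A < b)
    (hr : HasRate (fun n => (sepCard (mapCompInv g f) n δ : ℝ≥0∞)) A) :
    HasRate (fun n => (fiberSup g n : ℝ≥0∞)) b := by
  obtain ⟨C, hC⟩ := hr
  obtain ⟨N₀, hN₀⟩ := eventually_atTop.1 hC
  have h3A : 0 < 3 * A := by positivity
  have hr1 : 1 < b / (3 * A) := by rwa [one_lt_div h3A]
  -- N must be large enough to absorb C and the extra factor 3A due to orbits having N + 1 entries.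
  -- It then stays fixed, so 2^B is a constant.
  obtain ⟨N₁, hN₁⟩ := pow_unbounded_of_one_lt (C * (3 * A)) hr1
  set N := N₀ + N₁ + 1 with hN
  have hpow : C * (3 * A) ^ (N + 1) ≤ b ^ N := by
    have h1 : C * (3 * A) ≤ (b / (3 * A)) ^ N :=
      hN₁.le.trans (pow_le_pow_right₀ hr1.le (by omega))
    calc C * (3 * A) ^ (N + 1) = C * (3 * A) * (3 * A) ^ N := by ring
      _ ≤ (b / (3 * A)) ^ N * (3 * A) ^ N := by gcongr
      _ = b ^ N := by rw [← mul_pow, div_mul_cancel₀ _ h3A.ne']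
  obtain ⟨B, hB⟩ := ENat.ne_top_iff_exists.1 (fiberSup_ne_top hf N)
  have hb1 : 1 ≤ b := by
    have : (1 : ℝ≥0) ≤ 3 * A := hA.trans (le_mul_of_one_le_left (by positivity) (by norm_num))
    exact this.trans hb.le
  refine hasRate_fiberSup_of_multiples hg (k := N) (by omega) hb1 (C := 2 ^ B) fun m => ?_
  refine (ENat.toENNReal_mono (h.fiberSup_mul_le hfg hB.ge m)).trans ?_
  push_cast
  rw [mul_comm, pow_mul]
  gcongr
  calc (sepCard (mapCompInv g f) (N + 1) δ : ℝ≥0∞) * 3 ^ (N + 1)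
      ≤ (C * (A : ℝ≥0∞) ^ (N + 1)) * 3 ^ (N + 1) := by
        gcongr
        exact hN₀ (N + 1) (by omega)
    _ = ((C * (3 * A) ^ (N + 1) : ℝ≥0) : ℝ≥0∞) := by
        push_cast
        rw [mul_pow]
        ring
    _ ≤ _ := by exact_mod_cast hpow

/-- An orbit of g^k ∘ f^(-k) consists of every k-th entry of the orbit of g ∘ f⁻¹ with the same
parameter z. -/
theorem sepCard_iterate_le (hfg : StronglyCommuting f g) (k n : ℕ) (δ : ℝ) :
    sepCard (mapCompInv g^[k] f^[k]) (n + 1) δ ≤ sepCard (mapCompInv g f) (k * n + 1) δ := by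
  refine iSup₂_le fun S hS => ?_
  have hz : ∀ x : Fin (n + 1) → X, ∃ z : X, x ∈ S →
      ∀ i : Fin (n + 1), x i = f^[k * (n - i)] (g^[k * i] z) := fun x => by
    by_cases hx : x ∈ S
    · obtain ⟨z, hz⟩ := (hfg.iterate k k).mem_orbits_iff.1 (hS.1 hx)
      exact ⟨z, fun _ i => by rw [hz i, ← Function.iterate_mul, ← Function.iterate_mul]⟩
    · exact ⟨x 0, fun h => absurd h hx⟩
  choose z hz using hz
  let γ : (Fin (n + 1) → X) → Fin (k * n + 1) → X := fun x i => f^[k * n - i] (g^[i] (z x))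
  have hγ : ∀ x ∈ S, ∀ i : Fin (n + 1), γ x ⟨k * i, by
      have := Nat.mul_le_mul_left k (Nat.lt_succ_iff.1 i.2)
      omega⟩ = x i := fun x hx i => by
    rw [hz x hx i]
    simp only [γ, Nat.mul_sub]
  have hinj : InjOn γ S := fun x hx y hy hxy => funext fun i => by
    rw [← hγ x hx, hxy, hγ y hy]
  rw [← hinj.encard_image]
  refine le_iSup₂_of_le (γ '' S) ⟨?_, ?_⟩ le_rfl
  · rintro _ ⟨x, -, rfl⟩
    exact hfg.mem_orbits_iff.2 ⟨z x, fun _ => rfl⟩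
  · rintro _ ⟨x, hx, rfl⟩ _ ⟨y, hy, rfl⟩ hxy
    obtain ⟨i, hi⟩ := hS.2 hx hy fun h => hxy (h ▸ rfl)
    exact ⟨_, by rwa [hγ x hx i, hγ y hy i]⟩

theorem hasRate_sepCard_iterate (hfg : StronglyCommuting f g) {k : ℕ} (hk : 0 < k) {δ : ℝ}
    {a : ℝ≥0} (ha : 1 ≤ a)
    (h : HasRate (fun n => (sepCard (mapCompInv g f) n δ : ℝ≥0∞)) a) :
    HasRate (fun n => (sepCard (mapCompInv g^[k] f^[k]) n δ : ℝ≥0∞)) (a ^ k) := by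
  obtain ⟨C, hC⟩ := h
  obtain ⟨N, hN⟩ := eventually_atTop.1 hC
  refine ⟨C, eventually_atTop.2 ⟨N + 1, fun n hn => ?_⟩⟩
  obtain ⟨m, rfl⟩ : ∃ m, n = m + 1 := ⟨n - 1, by omega⟩
  have h1 : m ≤ k * m := Nat.le_mul_of_pos_left m hk
  refine (ENat.toENNReal_mono (sepCard_iterate_le hfg k m δ)).trans
    ((hN (k * m + 1) (by omega)).trans ?_)
  rw [ENNReal.coe_pow, ← pow_mul]
  gcongr
  · exact_mod_cast ha
  · rw [mul_add]
    omega

theorem setEntropy_mapCompInv_nonneg [Nonempty X] (hfg : StronglyCommuting f g) :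
    0 ≤ setEntropy (mapCompInv g f) := by
  refine le_iSup₂_of_le (1 : ℝ) one_pos ?_
  have h : (1 : ℕ → ℝ≥0∞) ≤ᶠ[atTop] fun n => (sepCard (mapCompInv g f) n 1 : ℝ≥0∞) := by
    filter_upwards [eventually_ge_atTop 1] with n hn
    obtain ⟨m, rfl⟩ : ∃ m, n = m + 1 := ⟨n - 1, by omega⟩
    obtain ⟨z⟩ := ‹Nonempty X›
    have : 1 ≤ sepCard (mapCompInv g f) (m + 1) 1 :=
      le_iSup₂_of_le {fun i : Fin (m + 1) => f^[m - i] (g^[i] z)}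
        ⟨singleton_subset_iff.2 (hfg.mem_orbits_iff.2 ⟨z, fun _ => rfl⟩), pairwise_singleton _ _⟩
        (by rw [encard_singleton])
    simpa using ENat.toENNReal_mono this
  have h' := ExpGrowth.expGrowthSup_eventually_monotone h
  have h1 : ExpGrowth.expGrowthSup (1 : ℕ → ℝ≥0∞) = 0 :=
    ExpGrowth.expGrowthSup_const one_ne_zero ENNReal.one_ne_top
  rw [h1] at h'
  exact h'

/-- If all iterates of `g` have fine colourings, then the growth rate of the fibres of `g` is at
most the entropy of `g ∘ f⁻¹`. -/
theorem fiberGrowth_le_setEntropy [Nonempty X] (hfg : StronglyCommuting f g)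
    (hf : fiberSup f 1 ≠ ⊤) (hg : fiberSup g 1 ≠ ⊤)
    (hcol : ∀ k, ∃ (ι : Type) (κ : X → ι) (δ : ℝ), IsFineColoring g^[k] κ δ) :
    fiberGrowth g ≤ setEntropy (mapCompInv g f) := by
  refine expGrowthSup_le_of_forall_hasRate (setEntropy_mapCompInv_nonneg hfg)
    fun a b ha hab hlt => ?_
  have ha0 : 0 < a := zero_lt_one.trans_le ha
  have hr1 : 1 < b / a := by rwa [one_lt_div ha0]
  -- For the k-th iterates the three colours cost log 3 per k steps, which fits between log a and
  -- log b.
  obtain ⟨k, hk⟩ := pow_unbounded_of_one_lt 3 hr1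
  have hk0 : 0 < k := Nat.pos_of_ne_zero fun h => by
    rw [h, pow_zero] at hk
    exact absurd hk (by norm_num)
  have hak : 3 * a ^ k < b ^ k := by
    rwa [div_pow, lt_div_iff₀ (by positivity)] at hk
  obtain ⟨ι, κ, δ, hκ⟩ := hcol k
  have hent : entropyAt (mapCompInv g f) δ < ENNReal.log a :=
    (le_iSup₂ (f := fun (ε : ℝ) (_ : 0 < ε) => entropyAt (mapCompInv g f) ε) δ hκ.pos).trans_lt hlt
  have h1 := hasRate_sepCard_iterate hfg hk0 ha (hasRate_of_expGrowthSup_lt hent)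
  have hfk : fiberSup f^[k] 1 ≠ ⊤ := by
    rw [fiberSup_iterate]
    exact fiberSup_ne_top hf _
  have hgk : fiberSup g^[k] 1 ≠ ⊤ := by
    rw [fiberSup_iterate]
    exact fiberSup_ne_top hg _
  have h2 := hκ.hasRate_fiberSup (hfg.iterate k k) hfk hgk (one_le_pow₀ ha) hak h1
  obtain ⟨C, hC⟩ := h2.exists_forall_le (fun n => by simpa using fiberSup_ne_top hgk n)
    (one_le_pow₀ (ha.trans hab.le))
  refine hasRate_fiberSup_of_multiples hg hk0 (ha.trans hab.le) (C := C) fun m => ?_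
  have := hC m
  rwa [fiberSup_iterate, ENNReal.coe_pow, ← pow_mul] at this

/-- Reversing the order of entries turns orbits of g ∘ f⁻¹ into orbits of f ∘ g⁻¹. -/
theorem sepCard_mapCompInv_swap (f g : X → X) (n : ℕ) (ε : ℝ) :
    sepCard (mapCompInv g f) n ε ≤ sepCard (mapCompInv f g) n ε := by
  refine iSup₂_le fun S hS => ?_
  have hinj : Function.Injective fun (x : Fin n → X) => x ∘ Fin.rev := fun x y hxy =>
    Fin.rev_surjective.injective_comp_right hxy
  rw [← hinj.encard_image]
  refine le_iSup₂_of_le _ ⟨?_, ?_⟩ le_rfl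
  · rintro _ ⟨x, hx, rfl⟩ i hi
    obtain ⟨z, hz, hz'⟩ := hS.1 hx (n - (i + 1) - 1) (by omega)
    refine ⟨z, ?_, ?_⟩
    · rw [mem_preimage, mem_singleton_iff, hz']
      exact congrArg x (Fin.ext (by simp only [Fin.val_rev]; omega))
    · rw [show f z = _ from hz]
      exact congrArg x (Fin.ext (by simp only [Fin.val_rev]; omega))
  · rintro _ ⟨x, hx, rfl⟩ _ ⟨y, hy, rfl⟩ hxy
    obtain ⟨i, hi⟩ := hS.2 hx hy fun h => hxy (h ▸ rfl)
    exact ⟨i.rev, by simpa using hi⟩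

theorem setEntropy_mapCompInv_swap (f g : X → X) :
    setEntropy (mapCompInv g f) = setEntropy (mapCompInv f g) := by
  have h : sepCard (mapCompInv g f) = sepCard (mapCompInv f g) := funext fun n => funext fun ε =>
    (sepCard_mapCompInv_swap f g n ε).antisymm (sepCard_mapCompInv_swap g f n ε)
  simp only [setEntropy, entropyAt, h]

end FiberGrowth

/-! ### Cut points of piecewise monotone maps -/

section Cuts

/-- Between any two points of a fibre of `f` there is a point of `D`. -/
def HasCuts (f : unitInterval → unitInterval) (D : Set unitInterval) : Prop :=
  ∀ x y, x < y → f x = f y → ∃ d ∈ D, x < d ∧ d < y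

theorem PiecewiseMonotone.exists_hasCuts {f : unitInterval → unitInterval}
    (h : PiecewiseMonotone f) : ∃ D : Set unitInterval, D.Finite ∧ HasCuts f D := by
  obtain ⟨n, c, hc, h0, h1, hinj⟩ := h
  refine ⟨range c, finite_range c, fun x y hxy hf => ?_⟩
  by_contra! hcon
  have hne : (Finset.univ.filter fun i => c i ≤ x).Nonempty :=
    ⟨0, by simp [h0]⟩
  obtain ⟨i, hi, hmax⟩ := Finset.exists_max_image _ id hne
  have hix : c i ≤ x := by simpa using hi
  have hil : i ≠ Fin.last n := by
    rintro rfl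
    rw [h1] at hix
    exact (hix.trans_lt hxy).not_ge unitInterval.le_one'
  obtain ⟨j, rfl⟩ := Fin.exists_castSucc_eq.2 hil
  have hj : x < c j.succ := by
    by_contra! hj
    have := hmax j.succ (by simpa using hj)
    exact (Fin.castSucc_lt_succ (i := j)).not_ge this
  have hjy : y ≤ c j.succ := hcon _ (mem_range_self _) hj
  exact hxy.ne (hinj j ⟨hix, hxy.le.trans hjy⟩ ⟨hix.trans hxy.le, hjy⟩ hf)

theorem exists_between_of_image {f : unitInterval → unitInterval} (hf : Continuous f)
    {x y t : unitInterval} (hxy : x < y) (ht : f x < t ∧ t < f y ∨ f y < t ∧ t < f x) :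
    ∃ s, x < s ∧ s < y ∧ f s = t := by
  rcases ht with ht | ht
  · obtain ⟨s, hs, rfl⟩ := intermediate_value_Ioo hxy.le hf.continuousOn ht
    exact ⟨s, hs.1, hs.2, rfl⟩
  · obtain ⟨s, hs, rfl⟩ := intermediate_value_Ioo' hxy.le hf.continuousOn ht
    exact ⟨s, hs.1, hs.2, rfl⟩

theorem encard_le_of_interleaved {S P : Set unitInterval}
    (h : ∀ x ∈ S, ∀ y ∈ S, x < y → ∃ z ∈ P, x < z ∧ z < y) : S.encard ≤ P.encard + 1 := by
  rcases P.finite_or_infinite with hP | hP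
  · by_contra! hlt
    rw [hP.encard_eq_coe_toFinset_card] at hlt
    have hlt' : ((hP.toFinset.card + 2 : ℕ) : ℕ∞) ≤ S.encard := by
      have := Order.add_one_le_of_lt hlt
      push_cast
      rwa [add_assoc, one_add_one_eq_two] at this
    obtain ⟨T, hTS, hT⟩ := exists_subset_encard_eq hlt'
    have hTf : T.Finite := finite_of_encard_eq_coe hT
    have := Finset.card_le_of_interleaved (s := hTf.toFinset) (t := hP.toFinset)
      fun x hx y hy hxy _ => by
        simpa using h x (hTS (by simpa using hx)) y (hTS (by simpa using hy)) hxy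
    rw [hTf.encard_eq_coe_toFinset_card] at hT
    have hT' : hTf.toFinset.card = hP.toFinset.card + 2 := by exact_mod_cast hT
    omega
  · rw [hP.encard_eq, top_add]
    exact le_top

namespace HasCuts

variable {f g : unitInterval → unitInterval} {D D' : Set unitInterval}

theorem fiberSup_ne_top (h : HasCuts f D) (hD : D.Finite) : fiberSup f 1 ≠ ⊤ := by
  refine ((iSup_le fun y => ?_ : fiberSup f 1 ≤ D.encard + 1).trans_lt ?_).ne
  · exact encard_le_of_interleaved fun a ha b hb hab => h a b hab (ha.trans hb.symm)
  · exact WithTop.add_lt_top.2 ⟨hD.encard_lt_top, ENat.natCast_lt_top 1⟩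

/-- If f separates the two points, a cut of g lies between their images and is pulled back by the
intermediate value theorem. -/
theorem comp (hg : HasCuts g D') (hf : HasCuts f D) (hfc : Continuous f) :
    HasCuts (g ∘ f) (D ∪ f ⁻¹' D') := by
  intro x y hxy he
  rcases lt_trichotomy (f x) (f y) with hlt | heq | hlt
  · obtain ⟨d, hd, h1⟩ := hg _ _ hlt he
    obtain ⟨s, h2, h3, rfl⟩ := exists_between_of_image hfc hxy (Or.inl h1)
    exact ⟨s, Or.inr hd, h2, h3⟩
  · obtain ⟨d, hd, h1⟩ := hf _ _ hxy heq
    exact ⟨d, Or.inl hd, h1⟩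
  · obtain ⟨d, hd, h1⟩ := hg _ _ hlt he.symm
    obtain ⟨s, h2, h3, rfl⟩ := exists_between_of_image hfc hxy (Or.inr h1)
    exact ⟨s, Or.inr hd, h2, h3⟩

theorem exists_iterate (h : HasCuts f D) (hD : D.Finite) (hfc : Continuous f) (k : ℕ) :
    ∃ E : Set unitInterval, E.Finite ∧ HasCuts f^[k] E := by
  induction k with
  | zero => exact ⟨∅, finite_empty, fun x y hxy he => absurd he hxy.ne⟩
  | succ k ih =>
    obtain ⟨E, hE, hcut⟩ := ih
    refine ⟨_, hD.union (hE.preimage' fun b _ => ?_), hcut.comp h hfc⟩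
    exact encard_lt_top_iff.1
      ((encard_fiber_le f 1 b).trans_lt (lt_top_iff_ne_top.2 (h.fiberSup_ne_top hD)))

/-- The colour of a point is its position relative to every cut. A ball too small to contain two
cuts sees only before, at and after one cut. -/
theorem exists_isFineColoring (h : HasCuts f D) (hD : D.Finite) :
    ∃ (ι : Type) (κ : unitInterval → ι) (δ : ℝ), IsFineColoring f κ δ := by
  obtain ⟨δ, hδ, hsep⟩ : ∃ δ : ℝ, 0 < δ ∧ ∀ d ∈ D, ∀ d' ∈ D, d ≠ d' → 2 * δ < dist d d' := by
    by_cases hnt : D.Nontrivial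
    · have := hD.to_subtype
      have hpos := infsep_pos_iff_nontrivial_of_finite.2 hnt
      refine ⟨D.infsep / 4, by positivity, fun d hd d' hd' hne => ?_⟩
      have := infsep_le_dist_of_mem hd hd' hne
      linarith
    · exact ⟨1, one_pos, fun d hd d' hd' hne => absurd ⟨d, hd, d', hd', hne⟩ hnt⟩
  refine ⟨D → Ordering, fun x d => cmp x d, δ, hδ, fun x y hxy hf => ?_, fun x => ?_⟩
  · by_contra hne
    rcases lt_or_gt_of_ne hne with hlt | hlt
    · obtain ⟨d, hd, h1, h2⟩ := h x y hlt hf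
      have := congrFun hxy ⟨d, hd⟩
      simp only [cmp_eq_lt_iff _ _ |>.2 h1, cmp_eq_gt_iff _ _ |>.2 h2] at this
      cases this
    · obtain ⟨d, hd, h1, h2⟩ := h y x hlt hf.symm
      have := congrFun hxy ⟨d, hd⟩
      simp only [cmp_eq_lt_iff _ _ |>.2 h1, cmp_eq_gt_iff _ _ |>.2 h2] at this
      cases this
  · have hball : ∀ y z d : unitInterval, dist x y ≤ δ → dist x z ≤ δ → cmp y d ≠ cmp z d →
        dist x d ≤ δ := by
      have hmid : ∀ y z d : unitInterval, dist x y ≤ δ → dist x z ≤ δ → y ≤ d → d ≤ z →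
          dist x d ≤ δ := by
        intro y z d hy hz h1 h2
        have h1' : (y : ℝ) ≤ d := h1
        have h2' : (d : ℝ) ≤ z := h2
        rw [Subtype.dist_eq, Real.dist_eq, abs_le] at *
        constructor <;> linarith
      intro y z d hy hz hne
      rcases le_total y d with h1 | h1 <;> rcases le_total d z with h2 | h2
      · exact hmid y z d hy hz h1 h2
      · rcases h1.lt_or_eq with h1 | rfl
        · rcases h2.lt_or_eq with h2 | rfl
          · exact absurd ((cmp_eq_lt_iff _ _).2 h1 ▸ ((cmp_eq_lt_iff _ _).2 h2).symm) hne
          · exact hz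
        · exact hy
      · rcases h1.lt_or_eq with h1 | rfl
        · rcases h2.lt_or_eq with h2 | rfl
          · exact absurd ((cmp_eq_gt_iff _ _).2 h1 ▸ ((cmp_eq_gt_iff _ _).2 h2).symm) hne
          · exact hz
        · exact hy
      · exact hmid z y d hz hy h2 h1
    by_cases hd₀ : ∃ d₀ ∈ D, dist x d₀ ≤ δ
    · obtain ⟨d₀, hd₀, hxd₀⟩ := hd₀
      let e : Ordering → Fin 3 := fun o => match o with
        | .lt => 0
        | .eq => 1
        | .gt => 2
      have he : ∀ a b, e a = e b → a = b := by decide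
      refine ⟨fun y => e (cmp y d₀), fun y z hy hz hyz => funext fun d => ?_⟩
      by_contra hne
      have hxd := hball y z d hy hz hne
      have hdd : (d : unitInterval) ≠ d₀ := fun hdd => hne (by
        simp only [hdd]
        exact he _ _ hyz)
      have h1 := hsep d d.2 d₀ hd₀ hdd
      have h2 := dist_triangle_left (d : unitInterval) d₀ x
      linarith
    · refine ⟨fun _ => 0, fun y z hy hz _ => funext fun d => ?_⟩
      by_contra hne
      exact hd₀ ⟨d, d.2, hball y z d hy hz hne⟩

end HasCuts

theorem IsFineColoring.restrict {X ι : Type*} [MetricSpace X] {g : X → X} {κ : X → ι} {δ : ℝ}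
    (h : IsFineColoring g κ δ) {J : Set X} {u : J → J} (hu : ∀ x, (u x : X) = g x) :
    IsFineColoring u (fun x => κ x) δ where
  pos := h.pos
  injective x y hκ he := Subtype.ext (h.injective x y hκ (by rw [← hu, ← hu, he]))
  local_le x := by
    obtain ⟨τ, hτ⟩ := h.local_le x
    exact ⟨fun y => τ y, fun y z => hτ y z⟩

end Cuts

/-! ### Upper bounds for the entropy -/

section UpperBound

open scoped NNReal

theorem exists_grid {ε : ℝ} (hε : 0 < ε) :
    ∃ Y : Finset unitInterval, ∀ u v, u < v → ε < dist u v → ∃ y ∈ Y, u < y ∧ y < v := by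
  obtain ⟨t, -, ht, hcov⟩ := finite_cover_balls_of_compact (isCompact_univ (X := unitInterval))
    (half_pos hε)
  refine ⟨ht.toFinset, fun u v huv hd => ?_⟩
  have huv' : (u : ℝ) < v := huv
  let m : unitInterval := ⟨((u : ℝ) + v) / 2, by
    constructor <;> linarith [u.2.1, u.2.2, v.2.1, v.2.2]⟩
  have hm := hcov (mem_univ m)
  simp only [mem_iUnion, Metric.mem_ball] at hm
  obtain ⟨y, hy, hmy⟩ := hm
  rw [Subtype.dist_eq, Real.dist_eq, abs_lt] at hmy
  rw [Subtype.dist_eq, Real.dist_eq, abs_of_neg (by linarith)] at hd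
  have hmv : (m : ℝ) = (u + v) / 2 := rfl
  refine ⟨y, by simpa using hy, ?_, ?_⟩
  · change (u : ℝ) < y
    linarith
  · change (y : ℝ) < v
    linarith

/-- Between two points of `S` some φ_i crosses a grid value, so `S` is interleaved with the
preimages of the grid. -/
theorem encard_le_of_separated {ε : ℝ} {Y : Finset unitInterval}
    (hY : ∀ u v, u < v → ε < dist u v → ∃ y ∈ Y, u < y ∧ y < v) (hε : 0 < ε) {ι : Type*}
    (Q : Finset ι) {φ : ι → unitInterval → unitInterval} (hφ : ∀ i, Continuous (φ i))
    {S : Set unitInterval}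
    (hS : ∀ x ∈ S, ∀ y ∈ S, x ≠ y → ∃ i ∈ Q, ε < dist (φ i x) (φ i y)) :
    S.encard ≤ ∑ i ∈ Q, ∑ y ∈ Y, (φ i ⁻¹' {y}).encard + 1 := by
  refine (encard_le_of_interleaved (P := ⋃ i ∈ Q, ⋃ y ∈ Y, φ i ⁻¹' {y}) ?_).trans ?_
  · intro x hx y hy hxy
    obtain ⟨i, hi, hd⟩ := hS x hx y hy hxy.ne
    have : ∃ t ∈ Y, φ i x < t ∧ t < φ i y ∨ φ i y < t ∧ t < φ i x := by
      rcases lt_trichotomy (φ i x) (φ i y) with hlt | heq | hlt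
      · obtain ⟨t, ht, h⟩ := hY _ _ hlt hd
        exact ⟨t, ht, Or.inl h⟩
      · rw [heq, dist_self] at hd
        exact absurd hd hε.not_gt
      · obtain ⟨t, ht, h⟩ := hY _ _ hlt (by rwa [dist_comm])
        exact ⟨t, ht, Or.inr h⟩
    obtain ⟨t, ht, hlt⟩ := this
    obtain ⟨s, h1, h2, h3⟩ := exists_between_of_image (hφ i) hxy hlt
    refine ⟨s, ?_, h1, h2⟩
    simp only [mem_iUnion]
    exact ⟨i, hi, t, ht, h3⟩
  · gcongr
    refine (Finset.set_encard_biUnion_le _ _).trans (Finset.sum_le_sum fun i _ => ?_)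
    exact Finset.set_encard_biUnion_le _ _

variable {f g : unitInterval → unitInterval}

theorem encard_fiber_comp_le {X : Type*} (f g : X → X) (l j : ℕ) (y : X) :
    ((fun x => f^[l] (g^[j] x)) ⁻¹' {y}).encard ≤ fiberSup f l * fiberSup g j :=
  (encard_le_encard_mul_of_fibers (t := f^[l] ⁻¹' {y}) g^[j] (fun _ hx => hx) (fiberSup g j)
    fun b _ => (encard_le_encard inter_subset_right).trans (encard_fiber_le g j b)).trans
    (mul_le_mul_left (encard_fiber_le f l y) _)

/-- A set of points which are separated by maps of the form `f^l ∘ g^j` with `l + j ≤ m`. -/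
theorem encard_le_of_separated_iterates (hf : Continuous f) (hg : Continuous g) {a C : ℝ≥0}
    (ha : 1 ≤ a) (hfC : ∀ n, (fiberSup f n : ℝ≥0∞) ≤ C * (a : ℝ≥0∞) ^ n)
    (hgC : ∀ n, (fiberSup g n : ℝ≥0∞) ≤ C * (a : ℝ≥0∞) ^ n) {ε : ℝ} {Y : Finset unitInterval}
    (hY : ∀ u v, u < v → ε < dist u v → ∃ y ∈ Y, u < y ∧ y < v) (hε : 0 < ε) {m : ℕ}
    (Q : Finset (ℕ × ℕ)) (hQ : ∀ q ∈ Q, q.1 + q.2 ≤ m) {S : Set unitInterval}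
    (hS : ∀ x ∈ S, ∀ y ∈ S, x ≠ y →
      ∃ q ∈ Q, ε < dist (f^[q.1] (g^[q.2] x)) (f^[q.1] (g^[q.2] y))) :
    (S.encard : ℝ≥0∞) ≤ Q.card * (Y.card * (C ^ 2 * (a : ℝ≥0∞) ^ m)) + 1 := by
  refine (ENat.toENNReal_mono (encard_le_of_separated hY hε Q
    (φ := fun q x => f^[q.1] (g^[q.2] x))
    (fun q => (hf.iterate _).comp (hg.iterate _)) hS)).trans ?_
  push_cast
  gcongr
  have hsum : ∀ (s : Finset (ℕ × ℕ)) (F : ℕ × ℕ → ℕ∞),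
      ((∑ i ∈ s, F i : ℕ∞) : ℝ≥0∞) = ∑ i ∈ s, (F i : ℝ≥0∞) :=
    fun s F => map_sum ENat.toENNRealRingHom F s
  have hsum' : ∀ (s : Finset unitInterval) (F : unitInterval → ℕ∞),
      ((∑ i ∈ s, F i : ℕ∞) : ℝ≥0∞) = ∑ i ∈ s, (F i : ℝ≥0∞) :=
    fun s F => map_sum ENat.toENNRealRingHom F s
  rw [hsum, ← nsmul_eq_mul]
  refine Finset.sum_le_card_nsmul _ _ _ fun q hq => ?_
  rw [hsum', ← nsmul_eq_mul]
  refine Finset.sum_le_card_nsmul _ _ _ fun y _ => ?_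
  refine (ENat.toENNReal_mono (encard_fiber_comp_le f g q.1 q.2 y)).trans ?_
  push_cast
  calc (fiberSup f q.1 : ℝ≥0∞) * fiberSup g q.2
      ≤ (C * (a : ℝ≥0∞) ^ q.1) * (C * (a : ℝ≥0∞) ^ q.2) := by
        gcongr
        · exact hfC _
        · exact hgC _
    _ = C ^ 2 * (a : ℝ≥0∞) ^ (q.1 + q.2) := by
        rw [pow_add]
        ring
    _ ≤ _ := by
        gcongr
        · exact_mod_cast ha
        · exact hQ q hq

theorem hasRate_of_le_linear_mul_pow {u : ℕ → ℝ≥0∞} {a b K : ℝ≥0} (ha : 1 ≤ a) (hab : a < b)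
    (h : ∀ n : ℕ, u (n + 1) ≤ (n + 1) * (K * (a : ℝ≥0∞) ^ n) + 1) : HasRate u b := by
  obtain ⟨C, hC⟩ := exists_linear_mul_pow_le ha hab
  refine ⟨(K + 1) * C, ?_⟩
  filter_upwards [eventually_ge_atTop 1] with n hn
  obtain ⟨m, rfl⟩ : ∃ m, n = m + 1 := ⟨n - 1, by omega⟩
  have ha' : (1 : ℝ≥0∞) ≤ a := by exact_mod_cast ha
  calc u (m + 1) ≤ (m + 1) * (K * (a : ℝ≥0∞) ^ m) + 1 := h m
    _ ≤ (m + 1) * (K * (a : ℝ≥0∞) ^ m) + (m + 1) * (a : ℝ≥0∞) ^ m := by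
        gcongr
        exact one_le_mul (by simp) (one_le_pow₀ ha')
    _ = (K + 1) * ((m + 1) * (a : ℝ≥0∞) ^ m) := by ring
    _ ≤ (K + 1) * (((m + 1 : ℕ) + 1) * (a : ℝ≥0∞) ^ (m + 1)) := by
        gcongr
        · simp
        · omega
    _ ≤ (K + 1) * (C * (b : ℝ≥0∞) ^ (m + 1)) := mul_le_mul_right (hC (m + 1)) _
    _ = _ := by
        push_cast
        ring

theorem exists_common_bound (hf : fiberSup f 1 ≠ ⊤) (hg : fiberSup g 1 ≠ ⊤) {a : ℝ≥0}
    (ha : 1 ≤ a) (h : max (fiberGrowth f) (fiberGrowth g) < ENNReal.log a) :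
    ∃ C : ℝ≥0, (∀ n, (fiberSup f n : ℝ≥0∞) ≤ C * (a : ℝ≥0∞) ^ n) ∧
      ∀ n, (fiberSup g n : ℝ≥0∞) ≤ C * (a : ℝ≥0∞) ^ n := by
  obtain ⟨h1, h2⟩ := max_lt_iff.1 h
  obtain ⟨C, hC⟩ := (hasRate_of_expGrowthSup_lt h1).exists_forall_le
    (fun n => by simpa using fiberSup_ne_top hf n) ha
  obtain ⟨D, hD⟩ := (hasRate_of_expGrowthSup_lt h2).exists_forall_le
    (fun n => by simpa using fiberSup_ne_top hg n) ha
  refine ⟨max C D, fun n => (hC n).trans ?_, fun n => (hD n).trans ?_⟩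
  · gcongr
    exact le_max_left _ _
  · gcongr
    exact le_max_right _ _

theorem setEntropy_mapCompInv_le (hf : Continuous f) (hg : Continuous g)
    (hfg : StronglyCommuting f g) (hf1 : fiberSup f 1 ≠ ⊤) (hg1 : fiberSup g 1 ≠ ⊤) :
    setEntropy (mapCompInv g f) ≤ max (fiberGrowth f) (fiberGrowth g) := by
  refine iSup₂_le fun ε hε => ?_
  refine expGrowthSup_le_of_forall_hasRate
    (u := fun n => (sepCard (mapCompInv g f) n ε : ℝ≥0∞))
    ((fiberGrowth_nonneg f).trans (le_max_left _ _)) fun a b ha hab hlt => ?_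
  obtain ⟨C, hfC, hgC⟩ := exists_common_bound hf1 hg1 ha hlt
  obtain ⟨Y, hY⟩ := exists_grid hε
  refine hasRate_of_le_linear_mul_pow (K := Y.card * C ^ 2) ha hab fun n => ?_
  simp only [sepCard, ENat.toENNReal_iSup]
  refine iSup₂_le fun S hS => ?_
  have hz : ∀ x : Fin (n + 1) → unitInterval, ∃ z, x ∈ S →
      ∀ i : Fin (n + 1), x i = f^[n - i] (g^[i] z) := fun x => by
    by_cases hx : x ∈ S
    · obtain ⟨z, hz⟩ := hfg.mem_orbits_iff.1 (hS.1 hx)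
      exact ⟨z, fun _ => hz⟩
    · exact ⟨0, fun h => absurd h hx⟩
  choose z hz using hz
  have hinj : InjOn z S := fun x hx y hy hxy => funext fun i => by
    rw [hz x hx, hz y hy, hxy]
  rw [← hinj.encard_image]
  refine (encard_le_of_separated_iterates hf hg ha hfC hgC hY hε (m := n)
    ((Finset.range (n + 1)).image fun i => (n - i, i)) ?_ ?_).trans ?_
  · simp only [Finset.mem_image, Finset.mem_range]
    rintro _ ⟨i, hi, rfl⟩
    dsimp only
    omega
  · rintro _ ⟨x, hx, rfl⟩ _ ⟨y, hy, rfl⟩ hxy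
    obtain ⟨i, hi⟩ := hS.2 hx hy fun h => hxy (h ▸ rfl)
    rw [hz x hx, hz y hy] at hi
    exact ⟨_, Finset.mem_image.2 ⟨i, Finset.mem_range.2 i.2, rfl⟩, hi⟩
  · have hcard : (((Finset.range (n + 1)).image fun i => (n - i, i)).card : ℝ≥0∞) ≤ n + 1 := by
      have := (Finset.card_image_le (s := Finset.range (n + 1)) (f := fun i => (n - i, i)))
      rw [Finset.card_range] at this
      exact_mod_cast this
    refine add_le_add_left ((mul_le_mul_left hcard _).trans (le_of_eq ?_)) 1
    push_cast
    ring

/-! ### Upper bound for the diagonal map -/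

namespace InverseLimit

theorem iterate_apply (x : InverseLimit f) (i k : ℕ) : f^[k] (x.1 (i + k)) = x.1 i := by
  induction k with
  | zero => rfl
  | succ k ih => rw [Function.iterate_succ_apply, ← add_assoc, x.2, ih]

theorem dist_le_of_forall_lt {ε : ℝ} {M : ℕ} (hM : (1 / 2 : ℝ) ^ M ≤ ε / 4)
    {x y : InverseLimit f} (h : ∀ i < M, dist (x.1 i) (y.1 i) ≤ ε / 4) : dist x y ≤ ε := by
  have hε : 0 ≤ ε / 4 := le_trans (by positivity) hM
  rw [dist_def, ← (summable_term x.1 y.1).sum_add_tsum_nat_add M]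
  have h1 : ∑ i ∈ Finset.range M, dist (x.1 i) (y.1 i) / 2 ^ i ≤ ε / 4 * 2 := by
    calc ∑ i ∈ Finset.range M, dist (x.1 i) (y.1 i) / 2 ^ i
        ≤ ∑ i ∈ Finset.range M, ε / 4 * (1 / 2) ^ i := by
          refine Finset.sum_le_sum fun i hi => ?_
          rw [one_div, inv_pow, ← div_eq_mul_inv]
          gcongr
          exact h i (Finset.mem_range.1 hi)
      _ ≤ ε / 4 * 2 := by
          rw [← Finset.mul_sum]
          gcongr
          exact (summable_geometric_two.sum_le_tsum _ fun _ _ => by positivity).trans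
            tsum_geometric_two.le
  have h2 : ∑' i, dist (x.1 (i + M)) (y.1 (i + M)) / 2 ^ (i + M) ≤ ε / 4 * 2 := by
    calc ∑' i, dist (x.1 (i + M)) (y.1 (i + M)) / 2 ^ (i + M)
        ≤ ∑' i : ℕ, (1 / 2 : ℝ) ^ M * (1 / 2) ^ i := by
          refine ((summable_nat_add_iff M).2 (summable_term x.1 y.1)).tsum_le_tsum (fun i => ?_)
            (summable_geometric_two.mul_left _)
          rw [← pow_add, add_comm M]
          exact term_le x.1 y.1 (i + M)
      _ ≤ ε / 4 * 2 := by
          rw [tsum_mul_left, tsum_geometric_two]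
          gcongr
  linarith

end InverseLimit

theorem diagonalMap_iterate_apply (h : ∀ x, f (g x) = g (f x)) (x : InverseLimit f) (j i : ℕ) :
    ((diagonalMap f g h)^[j] x).1 i = g^[j] (x.1 (i + j)) := by
  induction j generalizing i with
  | zero => rfl
  | succ j ih =>
    rw [Function.iterate_succ_apply', Function.iterate_succ_apply', ← add_assoc,
      add_right_comm, ← ih]
    rfl

theorem eq_iterate_of_mem_orbits {X : Type*} {T : X → X} {n : ℕ} {x : Fin (n + 1) → X}
    (hx : x ∈ orbits (fun x => {T x}) (n + 1)) (i : Fin (n + 1)) : x i = T^[i] (x 0) := by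
  obtain ⟨i, hi⟩ := i
  induction i with
  | zero => rfl
  | succ i ih =>
    rw [Function.iterate_succ_apply']
    refine (hx i hi).trans ?_
    rw [ih]

theorem mapEntropy_diagonalMap_le (hf : Continuous f) (hg : Continuous g)
    (hfg : StronglyCommuting f g) (hf1 : fiberSup f 1 ≠ ⊤) (hg1 : fiberSup g 1 ≠ ⊤) :
    mapEntropy (diagonalMap f g hfg.commute) ≤ max (fiberGrowth f) (fiberGrowth g) := by
  refine iSup₂_le fun ε hε => ?_
  set T := diagonalMap f g hfg.commute with hT
  refine expGrowthSup_le_of_forall_hasRate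
    (u := fun n => (sepCard (fun x => {T x}) n ε : ℝ≥0∞))
    ((fiberGrowth_nonneg f).trans (le_max_left _ _)) fun a b ha hab hlt => ?_
  obtain ⟨C, hfC, hgC⟩ := exists_common_bound hf1 hg1 ha hlt
  have hε4 : 0 < ε / 4 := by positivity
  obtain ⟨Y, hY⟩ := exists_grid hε4
  obtain ⟨M, hM⟩ := exists_pow_lt_of_lt_one hε4 (show (1 / 2 : ℝ) < 1 by norm_num)
  refine hasRate_of_le_linear_mul_pow (K := M * (Y.card * (C ^ 2 * a ^ M))) ha hab fun n => ?_
  simp only [sepCard, ENat.toENNReal_iSup]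
  refine iSup₂_le fun S hS => ?_
  -- Precision ε sees only coordinates i < M, and T^j reads coordinate i + j < n + M, so this one
  -- coordinate determines all that matters.
  let z : (Fin (n + 1) → InverseLimit f) → unitInterval := fun x => (x 0).1 (n + M)
  have hz : ∀ x ∈ S, ∀ (j : Fin (n + 1)) (i : ℕ), i < M →
      (x j).1 i = f^[n + M - (i + j)] (g^[j] (z x)) := by
    intro x hx j i hi
    have hj := j.2
    rw [eq_iterate_of_mem_orbits (hS.1 hx) j, diagonalMap_iterate_apply,
      ((hfg.iterate (n + M - (i + j)) j).commute _)]
    congr 1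
    have := InverseLimit.iterate_apply (x 0) (i + j) (n + M - (i + j))
    rw [← this, show i + j + (n + M - (i + j)) = n + M by omega]
  have hsep : ∀ x ∈ S, ∀ y ∈ S, x ≠ y → ∃ (j : Fin (n + 1)) (i : ℕ), i < M ∧
      ε / 4 < dist (f^[n + M - (i + j)] (g^[j] (z x))) (f^[n + M - (i + j)] (g^[j] (z y))) := by
    intro x hx y hy hxy
    obtain ⟨j, hj⟩ := hS.2 hx hy hxy
    by_contra! hcon
    refine hj.not_ge (InverseLimit.dist_le_of_forall_lt hM.le fun i hi => ?_)
    rw [hz x hx j i hi, hz y hy j i hi]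
    exact hcon j i hi
  have hinj : InjOn z S := fun x hx y hy hxy => by
    by_contra hne
    obtain ⟨j, i, -, h⟩ := hsep x hx y hy hne
    rw [hxy, dist_self] at h
    exact hε4.not_gt h
  rw [← hinj.encard_image]
  refine (encard_le_of_separated_iterates hf hg ha hfC hgC hY hε4 (m := n + M)
    ((Finset.range (n + 1) ×ˢ Finset.range M).image fun p => (n + M - (p.2 + p.1), p.1))
    ?_ ?_).trans ?_
  · simp only [Finset.mem_image, Finset.mem_product, Finset.mem_range]
    rintro _ ⟨⟨j, i⟩, ⟨hj, hi⟩, rfl⟩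
    dsimp only at *
    omega
  · rintro _ ⟨x, hx, rfl⟩ _ ⟨y, hy, rfl⟩ hxy
    obtain ⟨j, i, hi, h⟩ := hsep x hx y hy fun h => hxy (h ▸ rfl)
    exact ⟨_, Finset.mem_image.2 ⟨((j : ℕ), i), Finset.mem_product.2
      ⟨Finset.mem_range.2 j.2, Finset.mem_range.2 hi⟩, rfl⟩, h⟩
  · have hcard : (((Finset.range (n + 1) ×ˢ Finset.range M).image
        fun p => (n + M - (p.2 + p.1), p.1)).card : ℝ≥0∞) ≤ (n + 1) * M := by
      have := (Finset.card_image_le (s := Finset.range (n + 1) ×ˢ Finset.range M)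
        (f := fun p => (n + M - (p.2 + p.1), p.1)))
      rw [Finset.card_product, Finset.card_range, Finset.card_range] at this
      exact_mod_cast this
    refine add_le_add_left ((mul_le_mul_left hcard _).trans (le_of_eq ?_)) 1
    push_cast
    rw [pow_add]
    ring

end UpperBound

/-! ### Fibres over an invariant interval -/

section InvariantInterval

variable {u : unitInterval → unitInterval} {K J P D : Set unitInterval}

/-- The images of the points of `P` which are outside `J` all lie on the same side of `J`. -/
theorem same_side_of_injOn_insert (hu : Continuous u) (hP : P.OrdConnected) {a b e : unitInterval}
    (he : e ∉ P) (hinj : InjOn u (insert e P)) (hea : a ≤ u e) (heb : u e ≤ b) {x y : unitInterval}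
    (hx : x ∈ P) (hy : y ∈ P) (hxa : u x < a) (hyb : b < u y) : False := by
  have hlt : x ≠ y := by
    rintro rfl
    exact (hxa.trans_le (hea.trans heb)).asymm hyb
  have h1 : u x < u e := hxa.trans_le hea
  have h2 : u e < u y := heb.trans_lt hyb
  -- Otherwise the image of `P` would cross u e, contradicting injectivity on `P` together with the
  -- endpoint e.
  obtain ⟨t, ht, hte⟩ : ∃ t ∈ P, u t = u e := by
    rcases lt_or_gt_of_ne hlt with h | h
    · obtain ⟨t, h3, h4, h5⟩ := exists_between_of_image hu h (Or.inl ⟨h1, h2⟩)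
      exact ⟨t, hP.out hx hy ⟨h3.le, h4.le⟩, h5⟩
    · obtain ⟨t, h3, h4, h5⟩ := exists_between_of_image hu h (Or.inr ⟨h1, h2⟩)
      exact ⟨t, hP.out hy hx ⟨h3.le, h4.le⟩, h5⟩
  exact he (hinj (Or.inr ht) (Or.inl rfl) hte ▸ ht)

theorem HasCuts.injOn_of_ordConnected (hD : HasCuts u D) {Z : Set unitInterval}
    (hZ : Z.OrdConnected) (h : ∀ x ∈ Z, ∀ y ∈ Z, ∀ d ∈ D, x < d → d < y → d ∉ Z) :
    InjOn u Z := by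
  intro x hx y hy hxy
  by_contra hne
  rcases lt_or_gt_of_ne hne with hlt | hlt
  · obtain ⟨d, hd, h1, h2⟩ := hD x y hlt hxy
    exact h x hx y hy d hd h1 h2 (hZ.out hx hy ⟨h1.le, h2.le⟩)
  · obtain ⟨d, hd, h1, h2⟩ := hD y x hlt hxy.symm
    exact h y hy x hx d hd h1 h2 (hZ.out hy hx ⟨h1.le, h2.le⟩)

/-- A point of one of the sides `s i` of `J` is determined by the first point of its orbit
in `J`, or by any earlier point. -/
theorem iterate_injOn_sides {ι : Type*} {s : ι → Set unitInterval} (hinj : ∀ i, InjOn u (s i))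
    (hside : ∀ i, ∀ x ∈ s i, ∀ y ∈ s i, u x ∉ J → u y ∉ J → ∃ j, u x ∈ s j ∧ u y ∈ s j)
    (n : ℕ) (i : ι) {x y : unitInterval} (hx : x ∈ s i) (hy : y ∈ s i)
    (hxJ : ∀ j < n, u^[j] x ∉ J) (hyJ : ∀ j < n, u^[j] y ∉ J) (h : u^[n] x = u^[n] y) : x = y := by
  induction n generalizing i x y with
  | zero => exact h
  | succ n ih =>
    refine hinj i hx hy ?_
    rcases Nat.eq_zero_or_pos n with rfl | hn
    · exact h
    · obtain ⟨j, hj, hj'⟩ := hside i x hx y hy (hxJ 1 (by omega)) (hyJ 1 (by omega))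
      exact ih j hj hj' (fun k hk => hxJ (k + 1) (by omega)) (fun k hk => hyJ (k + 1) (by omega)) h

theorem fiberSup_restrict_le {X : Type*} {u : X → X} {J : Set X} (hJ : MapsTo u J J) (n : ℕ) :
    fiberSup (hJ.restrict u J J) n ≤ fiberSup u n := by
  refine iSup_le fun y => le_trans ?_ (encard_fiber_le u n y)
  rw [← Subtype.val_injective.encard_image]
  refine encard_le_encard ?_
  rintro _ ⟨z, rfl, rfl⟩
  rw [hJ.iterate_restrict]
  rfl

theorem encard_fiber_restrict_le (hJ : MapsTo u J J) (n : ℕ) (y : unitInterval) :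
    {z | z ∈ J ∧ u^[n] z = y}.encard ≤ fiberSup (hJ.restrict u J J) n := by
  by_cases hy : y ∈ J
  · refine le_trans ?_ (encard_fiber_le (hJ.restrict u J J) n ⟨y, hy⟩)
    rw [← Subtype.val_injective.encard_image (_ ⁻¹' _)]
    refine encard_le_encard ?_
    rintro z ⟨hz, rfl⟩
    refine ⟨⟨z, hz⟩, ?_, rfl⟩
    refine Subtype.ext ?_
    rw [hJ.iterate_restrict]
    rfl
  · have : {z | z ∈ J ∧ u^[n] z = y} = ∅ := eq_empty_of_forall_notMem fun z hz =>
      hy (hz.2 ▸ hJ.iterate n hz.1)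
    simp [this]

/-- Sort the points by the time t of first entry into `J`. Given the side and t, the entry point
determines the point, leaving a fibre of the (n - t)-th iterate on `J`. -/
theorem encard_fiber_inter_le {s : Bool → Set unitInterval} (hJ : MapsTo u J J)
    (hJne : J.Nonempty) (hK : K ⊆ J ∪ ⋃ i, s i) (hinj : ∀ i, InjOn u (s i))
    (hside : ∀ i, ∀ x ∈ s i, ∀ y ∈ s i, u x ∉ J → u y ∉ J → ∃ j, u x ∈ s j ∧ u y ∈ s j)
    (n : ℕ) (y : unitInterval) :
    {z | z ∈ K ∧ u^[n] z = y}.encard ≤ fiberSup (hJ.restrict u J J) n +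
      ∑ t ∈ Finset.range (n + 1), 2 * fiberSup (hJ.restrict u J J) (n - t) := by
  have : Nonempty J := hJne.to_subtype
  -- The value t = n also collects the points that have not entered `J` by time n.
  let T : ℕ → Bool → Set unitInterval := fun t i =>
    {z | z ∈ s i ∧ (∀ j < t, u^[j] z ∉ J) ∧ (t = n ∨ u^[t] z ∈ J) ∧ u^[n] z = y}
  have hT : ∀ t ≤ n, ∀ i, (T t i).encard ≤ fiberSup (hJ.restrict u J J) (n - t) := by
    intro t htn i
    have hinjT : InjOn u^[t] (T t i) := fun x hx z hz h =>
      iterate_injOn_sides hinj hside t i hx.1 hz.1 hx.2.1 hz.2.1 h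
    rcases htn.lt_or_eq with hlt | rfl
    · refine (encard_le_encard_of_injOn (fun z hz => ?_) hinjT).trans
        (encard_fiber_restrict_le hJ (n - t) y)
      refine ⟨hz.2.2.1.resolve_left hlt.ne, ?_⟩
      rw [← Function.iterate_add_apply, Nat.sub_add_cancel htn]
      exact hz.2.2.2
    · refine (encard_le_encard_of_injOn (t := {y}) (fun z hz => hz.2.2.2) hinjT).trans ?_
      rw [encard_singleton]
      exact one_le_fiberSup _ _
  have hsub : {z | z ∈ K ∧ u^[n] z = y} ⊆ {z | z ∈ J ∧ u^[n] z = y} ∪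
      ⋃ t ∈ Finset.range (n + 1), (T t true ∪ T t false) := by
    rintro z ⟨hzK, hz⟩
    rcases hK hzK with hzJ | hzs
    · exact Or.inl ⟨hzJ, hz⟩
    · refine Or.inr ?_
      obtain ⟨i, hi⟩ := mem_iUnion.1 hzs
      have hex : ∃ t, t = n ∨ u^[t] z ∈ J := ⟨n, Or.inl rfl⟩
      classical
      have hmem : z ∈ T (Nat.find hex) i :=
        ⟨hi, fun j hj hjJ => Nat.find_min hex hj (Or.inr hjJ), Nat.find_spec hex, hz⟩
      have hle : Nat.find hex ≤ n := Nat.find_min' hex (Or.inl rfl)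
      simp only [mem_iUnion, Finset.mem_range]
      refine ⟨Nat.find hex, by omega, ?_⟩
      cases i
      · exact Or.inr hmem
      · exact Or.inl hmem
  refine (encard_le_encard hsub).trans ((encard_union_le _ _).trans ?_)
  gcongr
  · exact encard_fiber_restrict_le hJ n y
  · refine (Finset.set_encard_biUnion_le _ _).trans (Finset.sum_le_sum fun t ht => ?_)
    have ht' : t ≤ n := Nat.lt_succ_iff.1 (Finset.mem_range.1 ht)
    rw [two_mul]
    exact (encard_union_le _ _).trans (add_le_add (hT t ht' _) (hT t ht' _))

end InvariantInterval

/-! ### The core of an interval map -/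

section Core

open scoped NNReal

/-- The intersection of the images of the iterates of `f`. -/
def core (f : unitInterval → unitInterval) : Set unitInterval := ⋂ k : ℕ, range f^[k]

variable {f g u : unitInterval → unitInterval}

theorem range_iterate_antitone {X : Type*} (f : X → X) : Antitone fun k => range f^[k] :=
  antitone_nat_of_succ_le fun k => by
    rw [Function.iterate_succ]
    exact range_comp_subset_range _ _

theorem ordConnected_range_iterate (hf : Continuous f) (k : ℕ) : (range f^[k]).OrdConnected :=
  (isPreconnected_range (hf.iterate k)).ordConnected

theorem isClosed_range_iterate (hf : Continuous f) (k : ℕ) : IsClosed (range f^[k]) :=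
  (isCompact_range (hf.iterate k)).isClosed

theorem isCompact_core (hf : Continuous f) : IsCompact (core f) :=
  (isClosed_iInter (isClosed_range_iterate hf)).isCompact

theorem ordConnected_core (hf : Continuous f) : (core f).OrdConnected :=
  ordConnected_iInter (ordConnected_range_iterate hf)

theorem nonempty_iInter_inter_range {C : Set unitInterval} (hC : IsClosed C) (hf : Continuous f)
    (h : ∀ k, (C ∩ range f^[k]).Nonempty) : (C ∩ core f).Nonempty := by
  rw [core, inter_iInter]
  exact IsCompact.nonempty_iInter_of_sequence_nonempty_isCompact_isClosed _
    (fun k => inter_subset_inter_right _ (range_iterate_antitone f k.le_succ)) h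
    (hC.inter (isClosed_range_iterate hf 0)).isCompact
    fun k => hC.inter (isClosed_range_iterate hf k)

theorem core_nonempty (hf : Continuous f) : (core f).Nonempty := by
  simpa using nonempty_iInter_inter_range isClosed_univ hf fun k => by
    rw [univ_inter]
    exact range_nonempty _

theorem mapsTo_range_iterate (h : ∀ x, f (u x) = u (f x)) (k : ℕ) :
    MapsTo u (range f^[k]) (range f^[k]) := by
  rintro _ ⟨x, rfl⟩
  have hc : Function.Commute f u := h
  exact ⟨u x, (hc.iterate_left k).eq x⟩

theorem mapsTo_core (h : ∀ x, f (u x) = u (f x)) : MapsTo u (core f) (core f) := fun _ hx =>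
  mem_iInter.2 fun k => mapsTo_range_iterate h k (mem_iInter.1 hx k)

theorem exists_mem_core_eq (hf : Continuous f) {x : unitInterval} (hx : x ∈ core f) :
    ∃ y ∈ core f, f y = x := by
  obtain ⟨y, hy, hy'⟩ := nonempty_iInter_inter_range (isClosed_singleton.preimage hf) hf
    (C := f ⁻¹' {x}) fun k => by
      obtain ⟨w, hw⟩ := mem_iInter.1 hx (k + 1)
      rw [Function.iterate_succ_apply'] at hw
      exact ⟨_, hw, mem_range_self w⟩
  exact ⟨y, hy', hy⟩

/-- Lifting f^k w = g x gives a k-th preimage of x. This is what keeps strong commutation valid on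
the core. -/
theorem StronglyCommuting.mem_core_of_image (hfg : StronglyCommuting f g) {x : unitInterval}
    (hx : g x ∈ core f) : x ∈ core f :=
  mem_iInter.2 fun k => by
    obtain ⟨w, hw⟩ := mem_iInter.1 hx k
    obtain ⟨z, hz, -⟩ := (hfg.iterate_left k).exists_lift hw
    exact ⟨z, hz⟩

theorem StronglyCommuting.restrict_core (hfg : StronglyCommuting f g) :
    StronglyCommuting ((mapsTo_core (f := f) fun _ => rfl).restrict f _ _)
      ((mapsTo_core hfg.commute).restrict g _ _) := by
  refine stronglyCommuting_iff.2 ⟨fun x => Subtype.ext (hfg.commute x), fun x y hxy => ?_⟩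
  obtain ⟨z, hz, hz'⟩ := hfg.exists_lift (congrArg Subtype.val hxy)
  have hzc : z ∈ core f := hfg.mem_core_of_image (by
    rw [hz']
    exact y.2)
  exact ⟨⟨z, hzc⟩, Subtype.ext hz, Subtype.ext hz'⟩

/-- The growth of the fibres of a map which commutes with `f` is already seen on the core
of `f`. -/
theorem fiberGrowth_le_restrict_core (hf : Continuous f) (hu : Continuous u)
    (h : ∀ x, f (u x) = u (f x)) {D : Set unitInterval} (hD : D.Finite) (hcut : HasCuts u D)
    (hf1 : fiberSup f 1 ≠ ⊤) :
    fiberGrowth u ≤ fiberGrowth ((mapsTo_core h).restrict u _ _) := by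
  have hu1 := hcut.fiberSup_ne_top hD
  have hne := core_nonempty hf
  have : Nonempty (core f) := hne.to_subtype
  set J := core f with hJdef
  set v := (mapsTo_core h).restrict u _ _ with hv
  obtain ⟨a, haJ, ha⟩ := (isCompact_core hf).exists_isLeast hne
  obtain ⟨b, hbJ, hb⟩ := (isCompact_core hf).exists_isGreatest hne
  -- The finitely many cuts outside the core leave the images of f^k after finitely many steps, so
  -- the two sides of `J` in `K` carry no cut of u.
  obtain ⟨k, hk⟩ : ∃ k, ∀ d ∈ D, d ∈ range f^[k] → d ∈ J := by
    have hex : ∀ d, ∃ k, d ∈ range f^[k] → d ∈ J := fun d => by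
      by_cases hd : d ∈ J
      · exact ⟨0, fun _ => hd⟩
      · obtain ⟨k, hk⟩ := not_forall.1 (mt mem_iInter.2 hd)
        exact ⟨k, fun h => absurd h hk⟩
    choose κ hκ using hex
    refine ⟨hD.toFinset.sup κ, fun d hd hdr => hκ d (range_iterate_antitone f ?_ hdr)⟩
    exact Finset.le_sup (hD.mem_toFinset.2 hd)
  set K := range f^[k] with hKdef
  have hKc : K.OrdConnected := ordConnected_range_iterate hf k
  have hJK : J ⊆ K := iInter_subset _ k
  have hKu : MapsTo u K K := mapsTo_range_iterate h k
  have hJu : MapsTo u J J := mapsTo_core h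
  let s : Bool → Set unitInterval := fun i => if i then K ∩ Iio a else K ∩ Ioi b
  have hcover : ∀ x ∈ K, x ∉ J → x < a ∨ b < x := fun x _ hxJ => by
    by_contra! hcon
    exact hxJ ((ordConnected_core hf).out haJ hbJ ⟨hcon.1, hcon.2⟩)
  have hinsL : InjOn u (insert a (K ∩ Iio a)) := by
    have he : insert a (K ∩ Iio a) = K ∩ Iic a := by
      rw [← Iio_insert, inter_insert_of_mem (hJK haJ)]
    rw [he]
    refine hcut.injOn_of_ordConnected (hKc.inter ordConnected_Iic)
      fun x hx y hy d hd h1 h2 hdZ => ?_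
    exact (ha (hk d hd hdZ.1)).not_gt (h2.trans_le hy.2)
  have hinsR : InjOn u (insert b (K ∩ Ioi b)) := by
    have he : insert b (K ∩ Ioi b) = K ∩ Ici b := by
      rw [← Ioi_insert, inter_insert_of_mem (hJK hbJ)]
    rw [he]
    refine hcut.injOn_of_ordConnected (hKc.inter ordConnected_Ici)
      fun x hx y hy d hd h1 h2 hdZ => ?_
    exact (hb (hk d hd hdZ.1)).not_gt (lt_of_le_of_lt hx.2 h1)
  have hbound : ∀ n y, {z | z ∈ K ∧ u^[n] z = y}.encard ≤ fiberSup v n +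
      ∑ t ∈ Finset.range (n + 1), 2 * fiberSup v (n - t) := by
    refine encard_fiber_inter_le (s := s) hJu hne ?_ ?_ ?_
    · intro x hx
      by_cases hxJ : x ∈ J
      · exact Or.inl hxJ
      · refine Or.inr (mem_iUnion.2 ?_)
        rcases hcover x hx hxJ with h | h
        · exact ⟨true, hx, h⟩
        · exact ⟨false, hx, h⟩
    · rintro (_ | _)
      · exact hinsR.mono (subset_insert _ _)
      · exact hinsL.mono (subset_insert _ _)
    · intro i x hx y hy hxJ hyJ
      have hsK : s i ⊆ K := by
        cases i
        · exact inter_subset_left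
        · exact inter_subset_left
      have hno : ∀ x ∈ s i, ∀ y ∈ s i, u x < a → b < u y → False := by
        intro x hx y hy
        cases i
        · exact same_side_of_injOn_insert hu (hKc.inter ordConnected_Ioi)
            (fun h => (mem_Ioi.1 h.2).ne rfl) hinsR (ha (hJu hbJ)) (hb (hJu hbJ)) hx hy
        · exact same_side_of_injOn_insert hu (hKc.inter ordConnected_Iio)
            (fun h => (mem_Iio.1 h.2).ne rfl) hinsL (ha (hJu haJ)) (hb (hJu haJ)) hx hy
      have hxK := hKu (hsK hx)
      have hyK := hKu (hsK hy)
      rcases hcover _ hxK hxJ with h1 | h1 <;> rcases hcover _ hyK hyJ with h2 | h2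
      · exact ⟨true, ⟨hxK, h1⟩, ⟨hyK, h2⟩⟩
      · exact (hno x hx y hy h1 h2).elim
      · exact (hno y hy x hx h2 h1).elim
      · exact ⟨false, ⟨hxK, h1⟩, ⟨hyK, h2⟩⟩
  have hcomm : Function.Commute f u := h
  -- f^k carries a fibre of u^n into a fibre of u^n inside `K`, at most `fiberSup f k` to one.
  have hfiber : ∀ n, fiberSup u n ≤
      (fiberSup v n + ∑ t ∈ Finset.range (n + 1), 2 * fiberSup v (n - t)) * fiberSup f k := by
    refine fun n => iSup_le fun y => ?_
    refine (encard_le_encard_mul_of_fibers (t := {z | z ∈ K ∧ u^[n] z = f^[k] y}) f^[k]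
      (fun z hz => ⟨mem_range_self z, ?_⟩) (fiberSup f k) fun w _ =>
        (encard_le_encard inter_subset_right).trans (encard_fiber_le f k w)).trans
      (mul_le_mul_left (hbound n _) _)
    rw [← show u^[n] z = y from hz]
    exact ((hcomm.iterate_iterate k n).eq z).symm
  have hv1 : fiberSup v 1 ≠ ⊤ :=
    ((fiberSup_restrict_le hJu 1).trans_lt (lt_top_iff_ne_top.2 hu1)).ne
  refine expGrowthSup_le_of_forall_hasRate (fiberGrowth_nonneg v) fun α β hα hαβ hlt => ?_
  obtain ⟨C, hC⟩ := (hasRate_of_expGrowthSup_lt hlt).exists_forall_le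
    (fun n => by simpa using fiberSup_ne_top hv1 n) hα
  obtain ⟨C', hC'⟩ := exists_linear_mul_pow_le hα hαβ
  obtain ⟨L, hL⟩ := ENat.ne_top_iff_exists.1 (fiberSup_ne_top hf1 k)
  refine ⟨3 * C * C' * L, Eventually.of_forall fun n => ?_⟩
  refine (ENat.toENNReal_mono (hfiber n)).trans ?_
  have hα' : (1 : ℝ≥0∞) ≤ α := by exact_mod_cast hα
  have hsum : ((∑ t ∈ Finset.range (n + 1), 2 * fiberSup v (n - t) : ℕ∞) : ℝ≥0∞) ≤
      (n + 1) * (2 * (C * (α : ℝ≥0∞) ^ n)) := by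
    rw [show ((∑ t ∈ Finset.range (n + 1), 2 * fiberSup v (n - t) : ℕ∞) : ℝ≥0∞) =
      ∑ t ∈ Finset.range (n + 1), ((2 * fiberSup v (n - t) : ℕ∞) : ℝ≥0∞) from
      map_sum ENat.toENNRealRingHom _ _]
    refine (Finset.sum_le_card_nsmul _ _ (2 * (C * (α : ℝ≥0∞) ^ n)) fun t _ => ?_).trans
      (le_of_eq ?_)
    · push_cast
      gcongr
      refine (hC _).trans ?_
      gcongr
      exact Nat.sub_le _ _
    · rw [Finset.card_range, nsmul_eq_mul]
      push_cast
      rfl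
  rw [← hL]
  push_cast
  calc ((fiberSup v n : ℝ≥0∞) +
        ((∑ t ∈ Finset.range (n + 1), 2 * fiberSup v (n - t) : ℕ∞) : ℝ≥0∞)) * L
      ≤ ((n + 1) * (C * (α : ℝ≥0∞) ^ n) + (n + 1) * (2 * (C * (α : ℝ≥0∞) ^ n))) * L := by
        gcongr
        refine (hC n).trans (le_mul_of_one_le_left zero_le ?_)
        simp
    _ = 3 * C * L * ((n + 1) * (α : ℝ≥0∞) ^ n) := by ring
    _ ≤ 3 * C * L * (C' * (β : ℝ≥0∞) ^ n) := mul_le_mul_right (hC' n) _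
    _ = _ := by ring

/-- Every point of the core is a coordinate of a point of the inverse limit. -/
theorem InverseLimit.exists_apply_eq (hf : Continuous f) (m : ℕ) {z : unitInterval}
    (hz : z ∈ core f) : ∃ x : InverseLimit f, x.1 m = z := by
  choose r hr hfr using fun w : core f => exists_mem_core_eq hf w.2
  let ρ : core f → core f := fun w => ⟨r w, hr w⟩
  -- ρ is a section of f on the core; applying f^m shifts the backward orbit of z so that z sits at
  -- coordinate m.
  refine ⟨⟨fun i => f^[m] (ρ^[i] ⟨z, hz⟩), fun i => ?_⟩, ?_⟩
  · rw [← Function.iterate_succ_apply' f, Function.iterate_succ_apply, Function.iterate_succ_apply']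
    exact congrArg _ (hfr _)
  · have key : ∀ n (w : core f), f^[n] (ρ^[n] w) = w := by
      intro n
      induction n with
      | zero => exact fun w => rfl
      | succ n ih =>
        intro w
        rw [Function.iterate_succ_apply, Function.iterate_succ_apply']
        have := hfr (ρ^[n] w)
        rw [show f (ρ (ρ^[n] w)) = ρ^[n] w from this, ih]
    exact key m ⟨z, hz⟩

theorem InverseLimit.dist_apply_zero_le (x y : InverseLimit f) :
    dist (x.1 0) (y.1 0) ≤ dist x y := by
  simpa using InverseLimit.term_le_dist x y 0

/-- Place the parameter z of an orbit at coordinate n of a point p. The zeroth coordinates of the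
Ψ-orbit of p are then the given orbit, and projecting to coordinate 0 does not increase distances.
-/
theorem setEntropy_restrict_core_le (hf : Continuous f) (hfg : StronglyCommuting f g) :
    setEntropy (mapCompInv ((mapsTo_core hfg.commute).restrict g _ _)
      ((mapsTo_core (f := f) fun _ => rfl).restrict f _ _)) ≤
      mapEntropy (diagonalMap f g hfg.commute) := by
  refine iSup₂_mono fun ε _ => ExpGrowth.expGrowthSup_eventually_monotone ?_
  filter_upwards [eventually_ge_atTop 1] with n hn
  obtain ⟨n, rfl⟩ : ∃ m, n = m + 1 := ⟨n - 1, by omega⟩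
  refine ENat.toENNReal_mono (iSup₂_le fun S hS => ?_)
  set T := diagonalMap f g hfg.commute with hT
  have hp : ∀ x : Fin (n + 1) → core f, ∃ p : InverseLimit f, x ∈ S →
      ∀ i : Fin (n + 1), (T^[i] p).1 0 = x i := fun x => by
    by_cases hx : x ∈ S
    · obtain ⟨z, hz⟩ := hfg.restrict_core.mem_orbits_iff.1 (hS.1 hx)
      obtain ⟨p, hp⟩ := InverseLimit.exists_apply_eq hf n z.2
      refine ⟨p, fun _ i => ?_⟩
      rw [hz i, diagonalMap_iterate_apply, MapsTo.iterate_restrict, MapsTo.iterate_restrict]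
      have h1 := InverseLimit.iterate_apply p (0 + i) (n - i)
      rw [show 0 + (i : ℕ) + (n - i) = n by omega, hp] at h1
      rw [← h1, ← (hfg.iterate (n - i) i).commute]
      rfl
    · obtain ⟨w, hw⟩ := core_nonempty hf
      obtain ⟨p, -⟩ := InverseLimit.exists_apply_eq hf 0 hw
      exact ⟨p, fun h => absurd h hx⟩
  choose p hp using hp
  let γ : (Fin (n + 1) → core f) → Fin (n + 1) → InverseLimit f := fun x i => T^[i] (p x)
  have hinj : InjOn γ S := fun x hx y hy hxy => funext fun i => Subtype.ext (by
    rw [← hp x hx i, ← hp y hy i]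
    exact congrArg (fun q : InverseLimit f => q.1 0) (congrFun hxy i))
  rw [← hinj.encard_image]
  refine le_iSup₂_of_le (γ '' S) ⟨?_, ?_⟩ le_rfl
  · rintro _ ⟨x, -, rfl⟩ i hi
    exact Function.iterate_succ_apply' T i (p x)
  · rintro _ ⟨x, hx, rfl⟩ _ ⟨y, hy, rfl⟩ hxy
    obtain ⟨i, hi⟩ := hS.2 hx hy fun h => hxy (h ▸ rfl)
    refine ⟨i, hi.trans_le ?_⟩
    rw [Subtype.dist_eq, ← hp x hx i, ← hp y hy i]
    exact InverseLimit.dist_apply_zero_le _ _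

end Core

/-! ### Entropy as growth of fibres -/

theorem HasCuts.exists_isFineColoring_iterate_restrict {u : unitInterval → unitInterval}
    {D J : Set unitInterval} (h : HasCuts u D) (hD : D.Finite) (hu : Continuous u)
    (hJ : MapsTo u J J) (k : ℕ) :
    ∃ (ι : Type) (κ : J → ι) (δ : ℝ), IsFineColoring (hJ.restrict u J J)^[k] κ δ := by
  obtain ⟨E, hE, hcut⟩ := h.exists_iterate hD hu k
  obtain ⟨ι, κ, δ, hκ⟩ := hcut.exists_isFineColoring hE
  refine ⟨ι, fun x => κ x, δ, hκ.restrict fun x => ?_⟩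
  rw [hJ.iterate_restrict]
  rfl

/-- The growth rates of the fibres of strongly commuting piecewise monotone maps are bounded by
the entropy of the restriction of `g ∘ f⁻¹` to an invariant set. -/
theorem max_fiberGrowth_restrict_le {f g : unitInterval → unitInterval} {D E J : Set unitInterval}
    (hf : Continuous f) (hg : Continuous g) (hD : D.Finite) (hfD : HasCuts f D) (hE : E.Finite)
    (hgE : HasCuts g E) (hJ : J.Nonempty) (hfJ : MapsTo f J J) (hgJ : MapsTo g J J)
    (hfg : StronglyCommuting (hfJ.restrict f J J) (hgJ.restrict g J J)) :
    max (fiberGrowth (hfJ.restrict f J J)) (fiberGrowth (hgJ.restrict g J J)) ≤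
      setEntropy (mapCompInv (hgJ.restrict g J J) (hfJ.restrict f J J)) := by
  have := hJ.to_subtype
  have hf1 := ((fiberSup_restrict_le hfJ 1).trans_lt
    (lt_top_iff_ne_top.2 (hfD.fiberSup_ne_top hD))).ne
  have hg1 := ((fiberSup_restrict_le hgJ 1).trans_lt
    (lt_top_iff_ne_top.2 (hgE.fiberSup_ne_top hE))).ne
  refine max_le ?_ ?_
  · rw [setEntropy_mapCompInv_swap]
    exact fiberGrowth_le_setEntropy hfg.symm hg1 hf1
      (hfD.exists_isFineColoring_iterate_restrict hD hf hfJ)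
  · exact fiberGrowth_le_setEntropy hfg hf1 hg1
      (hgE.exists_isFineColoring_iterate_restrict hE hg hgJ)

theorem setEntropy_mapCompInv_eq {f g : unitInterval → unitInterval} {D E : Set unitInterval}
    (hf : Continuous f) (hg : Continuous g) (hD : D.Finite) (hfD : HasCuts f D) (hE : E.Finite)
    (hgE : HasCuts g E) (hfg : StronglyCommuting f g) :
    setEntropy (mapCompInv g f) = max (fiberGrowth f) (fiberGrowth g) := by
  have hf1 := hfD.fiberSup_ne_top hD
  have hg1 := hgE.fiberSup_ne_top hE
  refine (setEntropy_mapCompInv_le hf hg hfg hf1 hg1).antisymm (max_le ?_ ?_)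
  · rw [setEntropy_mapCompInv_swap]
    refine fiberGrowth_le_setEntropy hfg.symm hg1 hf1 fun k => ?_
    obtain ⟨_, hfin, hcut⟩ := hfD.exists_iterate hD hf k
    exact hcut.exists_isFineColoring hfin
  · refine fiberGrowth_le_setEntropy hfg hf1 hg1 fun k => ?_
    obtain ⟨_, hfin, hcut⟩ := hgE.exists_iterate hE hg k
    exact hcut.exists_isFineColoring hfin

/-- The entropy of a piecewise monotone map is the growth rate of its fibres. -/
theorem mapEntropy_eq_fiberGrowth {g : unitInterval → unitInterval} {E : Set unitInterval}
    (hg : Continuous g) (hE : E.Finite) (hgE : HasCuts g E) : mapEntropy g = fiberGrowth g := by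
  -- The identity strongly commutes with g and has no cuts; its fibres are singletons, so it drops
  -- out of the maximum.
  have h := setEntropy_mapCompInv_eq (D := ∅) continuous_id hg finite_empty
    (fun x y hxy he => absurd he hxy.ne) hE hgE (StronglyCommuting.id_left g)
  rw [mapCompInv_id] at h
  exact h.trans (max_eq_right ((fiberGrowth_id_le _).trans (fiberGrowth_nonneg g)))

end

theorem corollary5p5 (f g : unitInterval → unitInterval)
    (hf : Continuous f) (hg : Continuous g)
    (hfm : PiecewiseMonotone f) (hgm : PiecewiseMonotone g)
    (hfg : StronglyCommuting f g) :
    setEntropy (mapCompInv g f) = max (mapEntropy f) (mapEntropy g) ∧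
    mapEntropy (diagonalMap f g hfg.commute) = max (mapEntropy f) (mapEntropy g) := by
  obtain ⟨D, hD, hfD⟩ := hfm.exists_hasCuts
  obtain ⟨E, hE, hgE⟩ := hgm.exists_hasCuts
  have hf1 := hfD.fiberSup_ne_top hD
  have hg1 := hgE.fiberSup_ne_top hE
  rw [mapEntropy_eq_fiberGrowth hf hD hfD, mapEntropy_eq_fiberGrowth hg hE hgE]
  refine ⟨setEntropy_mapCompInv_eq hf hg hD hfD hE hgE hfg,
    (mapEntropy_diagonalMap_le hf hg hfg hf1 hg1).antisymm ?_⟩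
  calc max (fiberGrowth f) (fiberGrowth g)
      ≤ max (fiberGrowth ((mapsTo_core (f := f) fun _ => rfl).restrict f _ _))
          (fiberGrowth ((mapsTo_core hfg.commute).restrict g _ _)) :=
        max_le_max (fiberGrowth_le_restrict_core hf hf (fun _ => rfl) hD hfD hf1)
          (fiberGrowth_le_restrict_core hf hg hfg.commute hE hgE hf1)
    _ ≤ _ := max_fiberGrowth_restrict_le hf hg hD hfD hE hgE (core_nonempty hf) _ _
        hfg.restrict_core
    _ ≤ _ := setEntropy_restrict_core_le hf hfg
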